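/- **Notation.** Let $V_n$ be the space of complex binary forms of degree $n$, on which $SL_2=SL_2(\mathbb C)$ acts by $(A\cdot f)(u,v)=f(A^{-1}(u,v)^T)$. Identify $\mathbb P^3$ with the projectivization of the space of complex $2\times2$ matrices and $\mathbb P^6$ with $\mathbb P(V_6)$, with coordinates $[a_0:\dots:a_6]$ for $f=\sum_i\sqrt{\binom 6i}\,a_iu^{6-i}v^i$. Let $f_1:\mathbb P^3\dashrightarrow\mathbb P^6$ be the rational map $[A]\mapsto[A\cdot uv(u^4-v^4)]$, extended from $SL_2$ to all matrices by forms of degree $6$ in the entries (use the adjugate of $A$ in place of $A^{-1}$). Let $\mathcal V_5=\overline{PSL_2\cdot uv(u^4-v^4)}\subset\mathbb P^6$ be the Fano threefold. A *sextic curve* is a morphism $F:\mathbb P^1\to\mathcal V_5\subset\mathbb P^6$ of degree $6$. Let $S_4^*\subset SU(2)$ be the binary octahedral group, generated by $\mathrm{diag}(\xi,\xi^{-1})$, $\xi=e^{2\pi i/8}$, and $\frac1{\sqrt2}\begin{pmatrix}1&-1\\1&1\end{pmatrix}$. Let $\varphi:\mathbb P^1\to\mathbb P^1$ be a branched Galois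 covering of degree $d\ge1$, that is, a morphism of degree $d$ whose group of covering transformations $G=\{\sigma\in\mathrm{Aut}(\mathbb P^1):\varphi\circ\sigma=\varphi\}$ has order $d$, and assume $G\subset SO(3)=SU(2)/\{\pm1\}$. Let $G^*\subset SU(2)$ be the preimage of $G$. For a homomorphism $\phi_2:G^*\to S_4^*$, let $G^*$ act on $V_n\otimes\mathbb C^2$ by the inclusion $G^*\subset SL_2$ on $V_n$ and through $\phi_2$ on $\mathbb C^2$; writing $(p,q)$ for $p\otimes e_1+q\otimes e_2$, this is $t\cdot(p,q)=(t\cdot p,\,t\cdot q)\,\phi_2(t)^T$. For morphisms $g:\mathbb P^1\to\mathbb P^3$ and $F:\mathbb P^1\to\mathbb P^6$ consider the diagram $$F\circ\varphi=f_1\circ g,\qquad(\ast)$$ which means that the image of $g$ is not contained in the indeterminacy locus of $f_1$ and that equality holds wherever $f_1\circ g$ is defined. **Theorem.** Let $n\ge0$. 1. Let $F$ be a sextic curve not contained in the closed $2$-dimensional orbit $\overline{PSL_2\cdot u^5v}$, and let $g=\begin{bmatrix}a&b\\c&e\end{bmatrix}:\mathbb P^1\to\mathbb P^3$ be a rational Galois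 lift of $F$ of degree $n$: $a,b,c,e\in V_n$ have no common zero, $(\ast)$ holds, and $G$ is realized faithfully on $g$ (if $\sigma\in G$ and $g\circ\sigma=g$, then $\sigma=1$). Then there is an injective homomorphism $\phi_2:G^*\to S_4^*$ such that, for the corresponding action of $G^*$ on $V_n\otimes\mathbb C^2$, the rows $(a,b)$ and $(c,e)$ of $g$ are linearly independent and the lines that they span are $1$-dimensional irreducible subrepresentations isomorphic to each other. 2. Conversely, let $\phi_2:G^*\to S_4^*$ be a homomorphism, let $W$ be a $1$-dimensional representation of $G^*$, and let $kW$ ($k\ge2$) be the $W$-isotypic component of $V_n\otimes\mathbb C^2$, the sum of all subrepresentations isomorphic to $W$. Let $(a,b),(c,e)\in kW$ be linearly independent and such that $f_1\begin{pmatrix}a&b\\c&e\end{pmatrix}$ does not vanish identically. Let $g:\mathbb P^1\to\mathbb P^3$ be the morphism induced by $\begin{pmatrix}a&b\\c&e\end{pmatrix}$ (after common factors of the four forms are removed). Then there is a unique morphism $F:\mathbb P^1\to\mathbb P^6$ such that $(\ast)$ holds. -/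

import Mathlib

open scoped LinearAlgebra.Projectivization TensorProduct MatrixGroups

noncomputable section

namespace GaloisLift

/-- The complex projective line. -/
abbrev P1 : Type := ℙ ℂ (Fin 2 → ℂ)

/-- Projective `3`-space, as the projectivization of the space of `2 × 2` matrices. -/
abbrev P3 : Type := ℙ ℂ (Matrix (Fin 2) (Fin 2) ℂ)

/-- Projective `6`-space with homogeneous coordinates `[a₀ : ⋯ : a₆]`. -/
abbrev P6 : Type := ℙ ℂ (Fin 7 → ℂ)

/-- The usual (quotient) topology of `P6`. -/
instance : TopologicalSpace P6 :=
  TopologicalSpace.coinduced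
    (fun v : {v : Fin 7 → ℂ // v ≠ 0} => Projectivization.mk ℂ v.1 v.2) inferInstance

/-! ### Binary forms -/

/-- `V n`: the binary forms of degree `n`. -/
abbrev V (n : ℕ) : Submodule ℂ (MvPolynomial (Fin 2) ℂ) :=
  MvPolynomial.homogeneousSubmodule (Fin 2) ℂ n

/-- The linear substitution `f ↦ f (B (u, v)ᵀ)`. -/
def subst (B : Matrix (Fin 2) (Fin 2) ℂ) :
    MvPolynomial (Fin 2) ℂ →ₐ[ℂ] MvPolynomial (Fin 2) ℂ :=
  MvPolynomial.aeval fun i => ∑ j, MvPolynomial.C (B i j) * MvPolynomial.X j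

theorem subst_one : subst 1 = AlgHom.id ℂ _ := by
  ext i : 1
  simp [subst, Matrix.one_apply]

theorem subst_mul (A B : Matrix (Fin 2) (Fin 2) ℂ) :
    subst (A * B) = (subst B).comp (subst A) := by
  ext i : 1
  simp only [subst, MvPolynomial.aeval_X, AlgHom.comp_apply, map_mul,
    Matrix.mul_apply, Fin.sum_univ_two, map_add, MvPolynomial.algHom_C,
    MvPolynomial.algebraMap_eq]
  ring

theorem subst_mem (B : Matrix (Fin 2) (Fin 2) ℂ) {n : ℕ} {f : MvPolynomial (Fin 2) ℂ}
    (hf : f ∈ V n) : subst B f ∈ V n := by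
  rw [MvPolynomial.mem_homogeneousSubmodule] at hf ⊢
  have h := hf.aeval (fun i => ∑ j, MvPolynomial.C (B i j) * MvPolynomial.X j) (n := 1)
    fun i => MvPolynomial.IsHomogeneous.sum _ _ _ fun j _ => by
      simpa using (MvPolynomial.isHomogeneous_C (Fin 2) (B i j)).mul
        (MvPolynomial.isHomogeneous_X ℂ j)
  simpa [subst] using h

/-- The action of `SL₂` on binary forms of degree `n`, `(A · f)(u, v) = f (A⁻¹ (u, v)ᵀ)`. -/
def formRep (n : ℕ) : Representation ℂ SL(2, ℂ) (V n) where
  toFun A := (subst (A⁻¹ : SL(2, ℂ)).1).toLinearMap.restrict fun _ hf => subst_mem _ hf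
  map_one' := by
    ext f : 2
    simp [subst_one]
  map_mul' A B := by
    ext f : 2
    simp [mul_inv_rev, subst_mul]

/-- The standard representation of `SL₂` on column vectors. -/
def stdRep : Representation ℂ SL(2, ℂ) (Fin 2 → ℂ) where
  toFun A := Matrix.toLin' A.1
  map_one' := by simp; rfl
  map_mul' A B := by simp [Matrix.toLin'_mul]; rfl

/-! ### Morphisms from the projective line -/

/-- `F : P1 → ℙ(E)` is a morphism of degree `m`: in homogeneous coordinates it is given by binary
forms of degree `m` without common zeros. -/
def IsMorphismOfDegree {E : Type*} [AddCommGroup E] [Module ℂ E] (m : ℕ) (F : P1 → ℙ ℂ E) :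
    Prop :=
  ∃ Φ : (Fin 2 → ℂ) → E,
    (∀ ℓ : Module.Dual ℂ E, ∃ p ∈ V m, ∀ x, ℓ (Φ x) = MvPolynomial.eval x p) ∧
    ∀ (x : Fin 2 → ℂ) (hx : x ≠ 0), ∃ h : Φ x ≠ 0,
      F (Projectivization.mk ℂ x hx) = Projectivization.mk ℂ (Φ x) h

/-- A (parametrized rational) curve in `ℙ(E)`. -/
def IsCurve {E : Type*} [AddCommGroup E] [Module ℂ E] (F : P1 → ℙ ℂ E) : Prop :=
  ∃ m, IsMorphismOfDegree m F

/-! ### Galois coverings of the projective line -/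

/-- The action of `SL₂` on the projective line. Its range is `Aut(P1) = PSL₂`. -/
def moebius : SL(2, ℂ) →* Equiv.Perm P1 :=
  MulAction.toPermHom SL(2, ℂ) P1

/-- `SU(2)` as a subgroup of `SL₂`. -/
def SU2 : Subgroup SL(2, ℂ) where
  carrier := {A | A.1 ∈ Matrix.unitaryGroup (Fin 2) ℂ}
  one_mem' := by simp
  mul_mem' hA hB := by simpa using mul_mem hA hB
  inv_mem' {A} hA := by
    have h : (A⁻¹ : SL(2, ℂ)).1 = star A.1 := by
      have h1 : star A.1 * A.1 = 1 := (Matrix.mem_unitaryGroup_iff').1 hA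
      have h2 : A.1 * (A⁻¹ : SL(2, ℂ)).1 = 1 := by
        rw [← Matrix.SpecialLinearGroup.coe_mul]; simp
      exact (left_inv_eq_right_inv h1 h2).symm
    change (A⁻¹ : SL(2, ℂ)).1 ∈ Matrix.unitaryGroup (Fin 2) ℂ
    rw [h]
    exact Unitary.star_mem hA

/-- `SO(3) = SU(2) / {± 1}`, as the group of rotations of the Riemann sphere. -/
def SO3 : Subgroup (Equiv.Perm P1) :=
  SU2.map moebius

/-- The group of covering transformations `{σ ∈ Aut(P1) | φ ∘ σ = φ}`. -/
def deckGroup (φ : P1 → P1) : Subgroup (Equiv.Perm P1) where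
  carrier := {σ | σ ∈ moebius.range ∧ ∀ p, φ (σ p) = φ p}
  one_mem' := ⟨one_mem _, fun _ => rfl⟩
  mul_mem' hσ hτ := ⟨mul_mem hσ.1 hτ.1, fun p => by
    rw [Equiv.Perm.mul_apply, hσ.2, hτ.2]⟩
  inv_mem' {σ} hσ := ⟨inv_mem hσ.1, fun p => by
    rw [← hσ.2 (σ⁻¹ p)]; simp⟩

/-- `φ` is a branched Galois covering of degree `d`: a morphism of degree `d ≥ 1` with exactly `d`
covering transformations. -/
def IsGaloisCovering (d : ℕ) (φ : P1 → P1) : Prop :=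
  0 < d ∧ IsMorphismOfDegree d φ ∧ Nat.card (deckGroup φ) = d

/-- The binary group `G* ⊂ SU(2)` associated with a subgroup `G` of `SO(3)`: the preimage of `G`
under `SU(2) → SO(3)`. -/
def binaryGroup (G : Subgroup (Equiv.Perm P1)) : Subgroup SL(2, ℂ) :=
  SU2 ⊓ G.comap moebius

/-! ### The Fano threefold `V₅` and the map `f₁` -/

/-- The coordinates `(a₀, …, a₆)` of a binary sextic `f = ∑ √(6 choose i) aᵢ u^(6-i) v^i`. -/
def sexticCoord (f : MvPolynomial (Fin 2) ℂ) : Fin 7 → ℂ := fun i =>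
  MvPolynomial.coeff (Finsupp.single 0 (6 - (i : ℕ)) + Finsupp.single 1 (i : ℕ)) f /
    (Real.sqrt (Nat.choose 6 i) : ℂ)

/-- The `PSL₂`-orbit of `[f]` in `ℙ(V₆) = P6`. -/
def orbit (f : V 6) : Set P6 :=
  {p | ∃ (A : SL(2, ℂ)) (h : sexticCoord (formRep 6 A f) ≠ 0),
    p = Projectivization.mk ℂ (sexticCoord (formRep 6 A f)) h}

/-- The binary sextic `u v (u⁴ - v⁴)`. -/
def octahedralForm : V 6 :=
  ⟨MvPolynomial.X 0 * MvPolynomial.X 1 * (MvPolynomial.X 0 ^ 4 - MvPolynomial.X 1 ^ 4), by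
    rw [MvPolynomial.mem_homogeneousSubmodule]
    exact ((MvPolynomial.isHomogeneous_X ℂ 0).mul (MvPolynomial.isHomogeneous_X ℂ 1)).mul
      (((MvPolynomial.isHomogeneous_X ℂ 0).pow 4).sub ((MvPolynomial.isHomogeneous_X ℂ 1).pow 4))⟩

/-- The binary sextic `u⁵ v`. -/
def tangentForm : V 6 :=
  ⟨MvPolynomial.X 0 ^ 5 * MvPolynomial.X 1, by
    rw [MvPolynomial.mem_homogeneousSubmodule]
    exact ((MvPolynomial.isHomogeneous_X ℂ 0).pow 5).mul (MvPolynomial.isHomogeneous_X ℂ 1)⟩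

/-- The Fano threefold `V₅`, the closure of `PSL₂ · uv(u⁴ - v⁴)`. -/
def fanoV5 : Set P6 := closure (orbit octahedralForm)

/-- The closed two-dimensional orbit, the closure of `PSL₂ · u⁵v`. -/
def closedTwoDimOrbit : Set P6 := closure (orbit tangentForm)

/-- A sextic curve in `V₅`. -/
def IsSexticCurve (F : P1 → P6) : Prop :=
  IsMorphismOfDegree 6 F ∧ ∀ p, F p ∈ fanoV5

/-- The rational map `f₁ : P3 ⇢ P6`, `[A] ↦ [A · uv(u⁴ - v⁴)]`, in homogeneous coordinates. It is
extended from `SL₂` to all matrices by writing the adjugate in place of the inverse, so that its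
components are forms of degree `6` in the entries of `A`; it is defined at `[A]` when
`f₁ A ≠ 0`. -/
def f₁ (A : Matrix (Fin 2) (Fin 2) ℂ) : Fin 7 → ℂ :=
  sexticCoord (subst A.adjugate octahedralForm.1)

theorem f₁_coe (A : SL(2, ℂ)) : f₁ A.1 = sexticCoord (formRep 6 A octahedralForm) := by
  simp [f₁, formRep, Matrix.SpecialLinearGroup.coe_inv]

/-- The square with sides `g`, `f₁`, `φ`, `F` commutes: the composite `f₁ ∘ g` exists (the image
of `g` is not contained in the indeterminacy locus of `f₁`), and `F ∘ φ = f₁ ∘ g` at every point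
at which `f₁ ∘ g` is defined. -/
def Commutes (φ : P1 → P1) (g : P1 → P3) (F : P1 → P6) : Prop :=
  (∃ (p : P1) (A : Matrix (Fin 2) (Fin 2) ℂ) (hA : A ≠ 0),
    g p = Projectivization.mk ℂ A hA ∧ f₁ A ≠ 0) ∧
  ∀ (p : P1) (A : Matrix (Fin 2) (Fin 2) ℂ) (hA : A ≠ 0), g p = Projectivization.mk ℂ A hA →
    ∀ h : f₁ A ≠ 0, F (φ p) = Projectivization.mk ℂ (f₁ A) h

/-- `g` is a rational Galois lift of `F` with Galois covering `φ`: the square commutes, and the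
covering group is realized faithfully on `g`, that is, only the trivial covering transformation
`σ` satisfies `g ∘ σ = g`. -/
def IsGaloisLift (φ : P1 → P1) (g : P1 → P3) (F : P1 → P6) : Prop :=
  Commutes φ g F ∧ ∀ σ ∈ deckGroup φ, (∀ p, g (σ p) = g p) → σ = 1

/-- The value at `x` of the matrix of binary forms with rows `(a, b)` and `(c, e)`. -/
def formMatrix {n : ℕ} (a b c e : V n) (x : Fin 2 → ℂ) : Matrix (Fin 2) (Fin 2) ℂ :=
  !![MvPolynomial.eval x a.1, MvPolynomial.eval x b.1;
     MvPolynomial.eval x c.1, MvPolynomial.eval x e.1]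

/-- `g : P1 → P3` is the morphism of degree `n` given by the matrix of binary forms of degree `n`
with rows `(a, b)` and `(c, e)`; in particular the four forms have no common zero. -/
def IsGivenBy {n : ℕ} (g : P1 → P3) (a b c e : V n) : Prop :=
  ∀ (x : Fin 2 → ℂ) (hx : x ≠ 0), ∃ h : formMatrix a b c e x ≠ 0,
    g (Projectivization.mk ℂ x hx) = Projectivization.mk ℂ (formMatrix a b c e x) h

/-- `g : P1 → P3` is the curve induced by the matrix of binary forms with rows `(a, b)` and
`(c, e)`, which may have common zeros: the morphism that agrees with the matrix wherever the
matrix does not vanish. -/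
def IsInducedBy {n : ℕ} (g : P1 → P3) (a b c e : V n) : Prop :=
  IsCurve g ∧ ∀ (x : Fin 2 → ℂ) (hx : x ≠ 0) (h : formMatrix a b c e x ≠ 0),
    g (Projectivization.mk ℂ x hx) = Projectivization.mk ℂ (formMatrix a b c e x) h

/-! ### Representations of the binary groups -/

/-- The matrix `T₁₁ = diag(ξ, ξ⁻¹)`, `ξ = exp(2πi/8)`. -/
def T₁₁ : SL(2, ℂ) :=
  ⟨!![Complex.exp (2 * Real.pi * Complex.I / 8), 0;
      0, (Complex.exp (2 * Real.pi * Complex.I / 8))⁻¹], by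
    simp [Matrix.det_fin_two, Complex.exp_ne_zero]⟩

/-- The matrix `T₃₀ = (1/√2) (1, -1; 1, 1)`. -/
def T₃₀ : SL(2, ℂ) :=
  ⟨!![(Real.sqrt 2 : ℂ)⁻¹, -(Real.sqrt 2 : ℂ)⁻¹; (Real.sqrt 2 : ℂ)⁻¹, (Real.sqrt 2 : ℂ)⁻¹], by
    have h : (Real.sqrt 2 : ℂ) * (Real.sqrt 2 : ℂ) = 2 := by
      rw [← Complex.ofReal_mul, Real.mul_self_sqrt (by norm_num)]; norm_num
    rw [Matrix.det_fin_two_of, neg_mul, sub_neg_eq_add, ← mul_inv, h]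
    norm_num⟩

/-- The binary octahedral group `S₄* ⊂ SU(2)`, of order `48`. -/
def binaryOctahedral : Subgroup SL(2, ℂ) :=
  Subgroup.closure {T₁₁, T₃₀}

/-- The action of `H ⊂ SL₂` on `V n ⊗ ℂ²` given by the inclusion `H → SL₂` on `V n` and by a
homomorphism `φ₂ : H → S₄*` on `ℂ²`. -/
def tensorRep (n : ℕ) {H : Subgroup SL(2, ℂ)} (φ₂ : H →* binaryOctahedral) :
    Representation ℂ H (V n ⊗[ℂ] (Fin 2 → ℂ)) :=
  Representation.tprod ((formRep n).comp H.subtype)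
    (stdRep.comp (binaryOctahedral.subtype.comp φ₂))

/-- The row vector `(p, q) = p ⊗ e₁ + q ⊗ e₂`. -/
def row {n : ℕ} (p q : V n) : V n ⊗[ℂ] (Fin 2 → ℂ) :=
  p ⊗ₜ[ℂ] Pi.single 0 1 + q ⊗ₜ[ℂ] Pi.single 1 1

/-- The subrepresentation `S` is `1`-dimensional and irreducible (its only
subrepresentations are zero and itself; see `Representation.IsIrreducible`). -/
def IsOneDimIrreducible {H U : Type*} [Group H] [AddCommMonoid U] [Module ℂ U]
    {ρ : Representation ℂ H U} (S : Subrepresentation ρ) : Prop :=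
  Module.finrank ℂ S.toSubmodule = 1 ∧ IsSimpleOrder (Subrepresentation S.toRepresentation)

/-- The isotypic component of type `σ`: the sum of all subrepresentations of `ρ` isomorphic
to `σ`. -/
def isotypic {H U W : Type*} [Group H] [AddCommMonoid U] [Module ℂ U] [AddCommMonoid W]
    [Module ℂ W] (ρ : Representation ℂ H U) (σ : Representation ℂ H W) : Submodule ℂ U :=
  ⨆ (S : Subrepresentation ρ) (_ : Nonempty (S.toRepresentation.Equiv σ)), S.toSubmodule

end GaloisLift

end

open GaloisLift

/-!
Part 1. Where `f₁` does not degenerate, two matrices have proportional images exactly when they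
differ, up to a scalar, by an element of `S₄*` acting on the right. Since `f₁ ∘ g = F ∘ φ` is
invariant under `G`, for every `t ∈ G*` and generic `x` the matrices `g (t⁻¹ x)` and `g x` are
related in this way; there are finitely many candidates in `S₄*`, each candidate gives a polynomial
condition on `x`, and so one candidate works for all `x`. The pairs `(t, s)` that occur form a
subgroup of `G* × S₄*`, the graph of an isomorphism modulo `{±1}` onto a subgroup. Its lift to `G*`
is a matter of signs: it can be corrected on a Sylow `2`-subgroup, and the sign character needed
there is extended to `G*` by transfer.

Part 2. On two eigenrows with the same character the components of `f₁` are semi-invariant forms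
of `G*` with a common character. Up to a common factor such forms are forms in the two forms that
define `φ`: by descent on the degree, dividing by the forms whose zeros are the fibres of `φ`. This
yields `F`, and `F` is unique because `φ` is surjective.
-/

namespace GaloisLift

open MvPolynomial

/-! ### Zeros and linear factors of binary forms -/

section BinaryForms

variable {K : Type*} [Field K] {m : ℕ} {p : MvPolynomial (Fin 2) K} {y : Fin 2 → K}

theorem eval_aeval {σ τ R : Type*} [CommSemiring R] (p : σ → MvPolynomial τ R)
    (q : MvPolynomial σ R) (x : τ → R) : eval x (aeval p q) = eval (fun i => eval x (p i)) q :=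
  comp_aeval_apply p (aeval x) q

theorem aeval_smul_of_isHomogeneous {σ R A : Type*} [CommSemiring R] [CommSemiring A] [Algebra R A]
    {p : MvPolynomial σ R} (hp : p.IsHomogeneous m) (c : A) (x : σ → A) :
    aeval (c • x) p = c ^ m * aeval x p := by
  simp only [aeval_def, eval₂_eq, Finset.mul_sum]
  refine Finset.sum_congr rfl fun d hd => ?_
  have hdeg : m = ∑ i ∈ d.support, d i := hp.degree_eq_sum_deg_support hd
  simp only [Pi.smul_apply, smul_eq_mul, mul_pow, Finset.prod_mul_distrib,
    Finset.prod_pow_eq_pow_sum, hdeg]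
  ring

theorem eval_smul_of_isHomogeneous {σ R : Type*} [CommSemiring R] {p : MvPolynomial σ R}
    (hp : p.IsHomogeneous m) (c : R) (x : σ → R) : eval (c • x) p = c ^ m * eval x p := by
  rw [← aeval_eq_eval, ← aeval_eq_eval]
  exact aeval_smul_of_isHomogeneous hp c x

theorem exists_isHomogeneous_mul_of_dvd {σ R : Type*} [CommRing R] {k : ℕ} {f p : MvPolynomial σ R}
    (hf : f.IsHomogeneous k) (hp : p.IsHomogeneous m) (h : f ∣ p) :
    ∃ r : MvPolynomial σ R, r.IsHomogeneous (m - k) ∧ p = f * r := by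
  classical
  let := gradedAlgebra (σ := σ) (R := R)
  obtain ⟨r, rfl⟩ := h
  let comp (q : MvPolynomial σ R) (i : ℕ) : homogeneousSubmodule σ R i :=
    DirectSum.decompose (homogeneousSubmodule σ R) q i
  have hcomp : (comp (f * r) m : MvPolynomial σ R) = f * r :=
    DirectSum.decompose_of_mem_same _ hp
  rcases le_or_gt k m with hkm | hmk
  · exact ⟨comp r (m - k), (comp r (m - k)).2, by
      rw [← DirectSum.coe_decompose_mul_of_left_mem_of_le _ hf hkm]
      exact hcomp.symm⟩
  · refine ⟨0, isHomogeneous_zero _ _ _, ?_⟩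
    rw [mul_zero, ← hcomp]
    exact DirectSum.coe_decompose_mul_of_left_mem_of_not_le _ hf hmk.not_ge

theorem eq_C_of_isHomogeneous_zero {σ R : Type*} [CommSemiring R] {p : MvPolynomial σ R}
    (hp : p.IsHomogeneous 0) : ∃ c, p = C c :=
  ⟨_, totalDegree_eq_zero_iff_eq_C.1 (Nat.le_zero.1 hp.totalDegree_le)⟩

/-- The linear form `y₁u - y₀v`, which generates the ideal of the point `[y]` of the projective
line. -/
noncomputable def wedge (y : Fin 2 → K) : MvPolynomial (Fin 2) K :=
  C (y 1) * X 0 - C (y 0) * X 1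

@[simp]
theorem eval_wedge (x y : Fin 2 → K) : eval x (wedge y) = y 1 * x 0 - y 0 * x 1 := by
  simp [wedge]

theorem isHomogeneous_wedge (y : Fin 2 → K) : (wedge y).IsHomogeneous 1 :=
  (isHomogeneous_C_mul_X _ _).sub (isHomogeneous_C_mul_X _ _)

theorem wedge_ne_zero (hy : y ≠ 0) : wedge y ≠ 0 := by
  intro h
  have h0 := eval_wedge ![0, 1] y
  have h1 := eval_wedge ![1, 0] y
  rw [h] at h0 h1
  refine hy (funext (Fin.forall_fin_two.2 ⟨?_, ?_⟩))
  · simpa using h0.symm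
  · simpa using h1.symm

theorem wedge_dvd_of_eval_eq_zero (hp : p.IsHomogeneous m) (hy : y ≠ 0) (h0 : eval y p = 0) :
    wedge y ∣ p := by
  obtain ⟨k, hk⟩ := Function.ne_iff.1 hy
  let π := Ideal.Quotient.mkₐ K (Ideal.span {wedge y})
  -- modulo `wedge y`, the variables form a multiple of the point `y`
  have hX : (fun i => π (X i)) = (algebraMap K _ (y k)⁻¹ * π (X k)) • (algebraMap K _ ∘ y) := by
    have hswap (i : Fin 2) : π (C (y k) * X i) = π (C (y i) * X k) := by
      refine Ideal.Quotient.eq.2 (Ideal.mem_span_singleton.2 ?_)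
      match i, k with
      | 0, 0 | 1, 1 => rw [sub_self]; exact dvd_zero _
      | 0, 1 => exact dvd_rfl
      | 1, 0 => exact ⟨-1, by rw [wedge]; ring⟩
    funext i
    have hunit : (algebraMap K (_ ⧸ Ideal.span {wedge y}) (y k)⁻¹) * algebraMap K _ (y k) = 1 := by
      rw [← map_mul, inv_mul_cancel₀ hk, map_one]
    have hi := hswap i
    rw [map_mul, map_mul, algHom_C, algHom_C] at hi
    calc π (X i) = algebraMap K _ (y k)⁻¹ * (algebraMap K _ (y k) * π (X i)) := by
          rw [← mul_assoc, hunit, one_mul]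
      _ = _ := by rw [hi]; simp only [Pi.smul_apply, Function.comp_apply, smul_eq_mul]; ring
  have hπ : π p = 0 := by
    rw [← aeval_X_left_apply p, ← AlgHom.comp_apply, comp_aeval, hX,
      aeval_smul_of_isHomogeneous hp, aeval_algebraMap_apply, aeval_eq_eval, h0, map_zero,
      mul_zero]
  exact Ideal.mem_span_singleton.1 (Ideal.Quotient.eq_zero_iff_mem.1 hπ)

theorem exists_wedge_mul (hp : p.IsHomogeneous m) (hy : y ≠ 0) (h0 : eval y p = 0) :
    ∃ r : MvPolynomial (Fin 2) K, r.IsHomogeneous (m - 1) ∧ p = wedge y * r :=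
  exists_isHomogeneous_mul_of_dvd (isHomogeneous_wedge y) hp (wedge_dvd_of_eval_eq_zero hp hy h0)

theorem prod_wedge_dvd {ι : Type*} (s : Finset ι) {y : ι → Fin 2 → K} (hy : ∀ i ∈ s, y i ≠ 0)
    (hpair : ∀ i ∈ s, ∀ j ∈ s, i ≠ j → eval (y i) (wedge (y j)) ≠ 0)
    (hp : p.IsHomogeneous m) (h0 : ∀ i ∈ s, eval (y i) p = 0) : ∏ i ∈ s, wedge (y i) ∣ p := by
  classical
  induction s using Finset.induction_on generalizing m p with
  | empty => simp
  | insert i s hi ih =>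
    simp only [Finset.forall_mem_insert] at hy hpair h0
    obtain ⟨r, hr, rfl⟩ := exists_wedge_mul hp hy.1 h0.1
    rw [Finset.prod_insert hi]
    refine mul_dvd_mul_left _ (ih hy.2 (fun j hj => (hpair.2 j hj).2) hr fun j hj => ?_)
    have hji : eval (y j) (wedge (y i)) ≠ 0 := (hpair.2 j hj).1 (ne_of_mem_of_not_mem hj hi)
    exact (mul_eq_zero.1 ((map_mul _ _ _).symm.trans (h0.2 j hj))).resolve_left hji

theorem exists_eval_eq_zero_of_pos [IsAlgClosed K] (hm : 0 < m) (hp : p.IsHomogeneous m) :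
    ∃ y : Fin 2 → K, y ≠ 0 ∧ eval y p = 0 := by
  by_contra! hcon
  have hline (z : K) : ![z, 1] ≠ 0 := fun h => one_ne_zero (congrFun h 1)
  let q : Polynomial K := aeval ![Polynomial.X, 1] p
  have hq (z : K) : q.eval z = eval ![z, 1] p := by
    have hcomp : (Polynomial.evalRingHom z).comp
        (aeval ![Polynomial.X, 1] : MvPolynomial (Fin 2) K →ₐ[K] Polynomial K).toRingHom =
        eval ![z, 1] := by
      ext i
      · simp
      · fin_cases i <;> simp
    exact RingHom.congr_fun hcomp p
  obtain ⟨c, hc⟩ : ∃ c, q = Polynomial.C c := by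
    refine ⟨_, Polynomial.eq_C_of_degree_eq_zero (by_contra fun hdeg => ?_)⟩
    obtain ⟨z, hz⟩ := IsAlgClosed.exists_root q hdeg
    exact hcon _ (hline z) (by rw [← hq]; exact hz)
  have hmonomial : X 1 * p = X 1 * (C c * X 1 ^ m) := by
    have : Infinite K := IsAlgClosed.instInfinite
    refine MvPolynomial.funext fun x => ?_
    rcases eq_or_ne (x 1) 0 with hx | hx
    · simp [hx]
    · have hx' : x = x 1 • ![x 0 / x 1, 1] :=
        funext (Fin.forall_fin_two.2 ⟨by simp [mul_div_cancel₀ _ hx], by simp⟩)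
      have heval : eval x p = x 1 ^ m * c := by
        conv_lhs => rw [hx', eval_smul_of_isHomogeneous hp, ← hq, hc, Polynomial.eval_C]
      simp [heval, mul_comm]
  refine hcon ![1, 0] (fun h => one_ne_zero (congrFun h 0)) ?_
  rw [mul_left_cancel₀ (X_ne_zero 1) hmonomial]
  simp [hm.ne']

/-- A family of binary forms is base point free if its members have no common nontrivial zero. -/
def IsBasePointFree {ι : Type*} (q : ι → MvPolynomial (Fin 2) K) : Prop :=
  ∀ y : Fin 2 → K, y ≠ 0 → ∃ i, eval y (q i) ≠ 0

theorem IsBasePointFree.exists_ne_zero {ι : Type*} {q : ι → MvPolynomial (Fin 2) K}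
    (hq : IsBasePointFree q) : ∃ i, q i ≠ 0 := by
  obtain ⟨i, hi⟩ := hq ![1, 0] fun h => one_ne_zero (congrFun h 0)
  exact ⟨i, fun h => hi (by rw [h, map_zero])⟩

theorem exists_mul_isBasePointFree {ι : Type*} {p : ι → MvPolynomial (Fin 2) K}
    (hp : ∀ i, (p i).IsHomogeneous m) (hp0 : ∃ i, p i ≠ 0) :
    ∃ (k : ℕ) (γ : MvPolynomial (Fin 2) K) (q : ι → MvPolynomial (Fin 2) K),
      γ ≠ 0 ∧ (∀ i, (q i).IsHomogeneous k) ∧ (∀ i, p i = γ * q i) ∧ IsBasePointFree q := by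
  induction m generalizing p with
  | zero =>
    obtain ⟨i, hi⟩ := hp0
    refine ⟨0, 1, p, one_ne_zero, hp, by simp, fun y _ => ⟨i, ?_⟩⟩
    obtain ⟨c, hc⟩ := eq_C_of_isHomogeneous_zero (hp i)
    rw [hc, Ne, C_eq_zero] at hi
    rwa [hc, eval_C]
  | succ m ih =>
    by_cases hfree : IsBasePointFree p
    · exact ⟨m + 1, 1, p, one_ne_zero, hp, by simp, hfree⟩
    simp only [IsBasePointFree] at hfree
    push Not at hfree
    obtain ⟨y, hy, hyp⟩ := hfree
    choose r hr hpr using fun i => exists_wedge_mul (hp i) hy (hyp i)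
    obtain ⟨k, γ, q, hγ, hq, hrq, hfree⟩ :=
      ih hr (hp0.imp fun i hi => right_ne_zero_of_mul (hpr i ▸ hi))
    exact ⟨k, wedge y * γ, q, mul_ne_zero (wedge_ne_zero hy) hγ, hq,
      fun i => by rw [hpr i, hrq i, mul_assoc], hfree⟩

theorem IsBasePointFree.dvd_of_forall_dvd_mul [IsAlgClosed K] {ι : Type*}
    {q : ι → MvPolynomial (Fin 2) K} (hq : IsBasePointFree q) {k : ℕ} {h : MvPolynomial (Fin 2) K}
    (hh : h.IsHomogeneous k) (hp : p.IsHomogeneous m) (hdvd : ∀ i, h ∣ p * q i) : h ∣ p := by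
  rcases eq_or_ne h 0 with rfl | h0
  · obtain ⟨i, hi⟩ := hq.exists_ne_zero
    exact zero_dvd_iff.2 ((mul_eq_zero.1 (zero_dvd_iff.1 (hdvd i))).resolve_right hi)
  induction k generalizing m h p with
  | zero =>
    obtain ⟨c, rfl⟩ := eq_C_of_isHomogeneous_zero hh
    rw [Ne, C_eq_zero] at h0
    exact ((isUnit_iff_ne_zero.2 h0).map C).dvd
  | succ k ih =>
    obtain ⟨y, hy, hyh⟩ := exists_eval_eq_zero_of_pos k.succ_pos hh
    obtain ⟨h, hh', rfl⟩ := exists_wedge_mul hh hy hyh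
    obtain ⟨i, hi⟩ := hq y hy
    have hyp : eval y p = 0 := by
      obtain ⟨r, hr⟩ := hdvd i
      have hyr := congrArg (eval y) hr
      rw [map_mul, map_mul, hyh, zero_mul] at hyr
      exact (mul_eq_zero.1 hyr).resolve_right hi
    obtain ⟨p, hp', rfl⟩ := exists_wedge_mul hp hy hyp
    refine mul_dvd_mul_left _ (ih hh' hp' (fun j => ?_) (right_ne_zero_of_mul h0))
    exact (mul_dvd_mul_iff_left (wedge_ne_zero hy)).1 (by rw [← mul_assoc]; exact hdvd j)

theorem IsBasePointFree.exists_eq_C_mul [IsAlgClosed K] {ι : Type*}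
    {p q : ι → MvPolynomial (Fin 2) K} (hfree : IsBasePointFree q)
    (hp : ∀ i, (p i).IsHomogeneous m) (hq : ∀ i, (q i).IsHomogeneous m)
    (hpq : ∀ i j, p i * q j = p j * q i) : ∃ c : K, ∀ i, p i = C c * q i := by
  obtain ⟨i, hi⟩ := hfree.exists_ne_zero
  have hdvd : q i ∣ p i :=
    hfree.dvd_of_forall_dvd_mul (hq i) (hp i) fun j => ⟨p j, by rw [hpq i j, mul_comm]⟩
  obtain ⟨r, hr, hpi⟩ := exists_isHomogeneous_mul_of_dvd (hq i) (hp i) hdvd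
  obtain ⟨c, rfl⟩ := eq_C_of_isHomogeneous_zero (Nat.sub_self m ▸ hr)
  refine ⟨c, fun j => mul_right_cancel₀ hi ?_⟩
  rw [hpq j i, hpi]
  ring

end BinaryForms

/-! ### The octahedral form and the map `f₁` -/

section Octahedral

theorem eval_subst (B : Matrix (Fin 2) (Fin 2) ℂ) (p : MvPolynomial (Fin 2) ℂ) (x : Fin 2 → ℂ) :
    eval x (subst B p) = eval (B.mulVec x) p := by
  rw [subst, eval_aeval]
  simp only [map_sum, map_mul, eval_C, eval_X]
  rfl

theorem subst_smul {m : ℕ} {p : MvPolynomial (Fin 2) ℂ} (hp : p ∈ V m) (c : ℂ)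
    (B : Matrix (Fin 2) (Fin 2) ℂ) : subst (c • B) p = c ^ m • subst B p :=
  MvPolynomial.funext fun x => by
    rw [eval_subst, Matrix.smul_mulVec, eval_smul_of_isHomogeneous hp, smul_eval, eval_subst]

theorem isLinearMap_sexticCoord : IsLinearMap ℂ sexticCoord where
  map_add p q := by ext i; simp [sexticCoord, add_div]
  map_smul c p := by ext i; simp [sexticCoord, mul_div_assoc]

theorem eq_zero_of_sexticCoord_eq_zero {p : MvPolynomial (Fin 2) ℂ} (hp : p ∈ V 6)
    (h : sexticCoord p = 0) : p = 0 := by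
  ext d
  by_contra hne
  have hdeg : d 0 + d 1 = 6 := by
    have := hp hne
    rwa [Finsupp.weight_apply, Finsupp.sum_fintype _ _ (by simp), Fin.sum_univ_two, smul_eq_mul,
      smul_eq_mul, Pi.one_apply, Pi.one_apply, mul_one, mul_one] at this
  have hd : (Finsupp.single 0 (6 - d 1) + Finsupp.single 1 (d 1) : Fin 2 →₀ ℕ) = d := by
    rw [← hdeg, Nat.add_sub_cancel]
    ext i
    fin_cases i <;> simp
  have hchoose : (Real.sqrt (Nat.choose 6 (d 1)) : ℂ) ≠ 0 := by
    rw [Ne, Complex.ofReal_eq_zero, Real.sqrt_eq_zero (Nat.cast_nonneg _), Nat.cast_eq_zero]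
    exact (Nat.choose_pos (by omega)).ne'
  have hcoord := congrFun h ⟨d 1, by omega⟩
  rw [sexticCoord, hd, Pi.zero_apply, div_eq_zero_iff] at hcoord
  exact hcoord.elim hne hchoose

theorem sexticCoord_injOn : Set.InjOn sexticCoord (V 6) := fun p hp q hq h =>
  sub_eq_zero.1 (eq_zero_of_sexticCoord_eq_zero (sub_mem hp hq) (by
    rw [isLinearMap_sexticCoord.map_sub, h, sub_self]))

theorem f₁_smul (c : ℂ) (A : Matrix (Fin 2) (Fin 2) ℂ) : f₁ (c • A) = c ^ 6 • f₁ A := by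
  rw [f₁, Matrix.adjugate_smul, Fintype.card_fin, pow_one, subst_smul octahedralForm.2,
    isLinearMap_sexticCoord.map_smul, f₁]

theorem eval_octahedralForm (x : Fin 2 → ℂ) :
    eval x octahedralForm.1 = x 0 * x 1 * (x 0 ^ 4 - x 1 ^ 4) := by
  simp [octahedralForm]

theorem octahedralForm_ne_zero : octahedralForm.1 ≠ 0 := by
  intro h
  have h21 := eval_octahedralForm ![2, 1]
  rw [h] at h21
  norm_num at h21

theorem subst_octahedralForm_eq_smul_iff (A : Matrix (Fin 2) (Fin 2) ℂ) (ε : ℂ) :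
    subst A octahedralForm.1 = ε • octahedralForm.1 ↔ ∀ u v,
      (A 0 0 * u + A 0 1 * v) * (A 1 0 * u + A 1 1 * v) *
        ((A 0 0 * u + A 0 1 * v) ^ 4 - (A 1 0 * u + A 1 1 * v) ^ 4) =
      ε * (u * v * (u ^ 4 - v ^ 4)) := by
  have heval (x : Fin 2 → ℂ) : eval x (subst A octahedralForm.1) =
      (A 0 0 * x 0 + A 0 1 * x 1) * (A 1 0 * x 0 + A 1 1 * x 1) *
        ((A 0 0 * x 0 + A 0 1 * x 1) ^ 4 - (A 1 0 * x 0 + A 1 1 * x 1) ^ 4) := by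
    simp only [eval_subst, eval_octahedralForm, Matrix.mulVec, dotProduct, Fin.sum_univ_two]
  rw [MvPolynomial.funext_iff]
  simp only [heval, smul_eval, eval_octahedralForm]
  exact ⟨fun h u v => h ![u, v], fun h x => h (x 0) (x 1)⟩

/-- The stabilizer in `SL₂` of the point `[uv(u⁴ - v⁴)]` of `ℙ(V₆)`. -/
noncomputable def octahedralStabilizer : Subgroup SL(2, ℂ) where
  carrier := {A | ∃ ε : ℂˣ, subst A.1 octahedralForm.1 = ε.1 • octahedralForm.1}
  one_mem' := ⟨1, by simp [subst_one]⟩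
  mul_mem' := by
    rintro A B ⟨ε, hA⟩ ⟨δ, hB⟩
    exact ⟨ε * δ, by
      rw [Matrix.SpecialLinearGroup.coe_mul, subst_mul, AlgHom.comp_apply, hA, map_smul, hB,
        smul_smul, Units.val_mul]⟩
  inv_mem' := by
    rintro A ⟨ε, hA⟩
    refine ⟨ε⁻¹, ?_⟩
    have h : subst (A⁻¹ : SL(2, ℂ)).1 (subst A.1 octahedralForm.1) = octahedralForm.1 := by
      rw [← AlgHom.comp_apply, ← subst_mul, ← Matrix.SpecialLinearGroup.coe_mul, mul_inv_cancel,
        Matrix.SpecialLinearGroup.coe_one, subst_one, AlgHom.id_apply]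
    rw [hA, map_smul] at h
    rw [← h, smul_smul, Units.inv_mul, one_smul, h]

/-- The primitive eighth root of unity `ξ = exp(2πi/8)`, the upper left entry of `T₁₁`. -/
noncomputable def xi : ℂ := Complex.exp (2 * Real.pi * Complex.I / 8)

theorem xi_primitive : IsPrimitiveRoot xi 8 := by
  simpa only [xi, Nat.cast_ofNat] using Complex.isPrimitiveRoot_exp 8 (by norm_num)

theorem xi_ne_zero : xi ≠ 0 := Complex.exp_ne_zero _

theorem coe_T₁₁ : T₁₁.1 = Matrix.diagonal ![xi, xi⁻¹] :=
  (Matrix.diagonal_fin_two ![xi, xi⁻¹]).symm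

theorem coe_T₁₁_pow (k : ℕ) : (T₁₁ ^ k).1 = !![xi ^ k, 0; 0, (xi ^ k)⁻¹] := by
  rw [Matrix.SpecialLinearGroup.coe_pow, coe_T₁₁, Matrix.diagonal_pow, Matrix.diagonal_fin_two]
  simp

theorem coe_T₃₀ : T₃₀.1 = (Real.sqrt 2 : ℂ)⁻¹ • !![1, -1; 1, 1] := by
  simp [T₃₀]

theorem inv_sqrt_two_sq : ((Real.sqrt 2 : ℂ)⁻¹) ^ 2 = 2⁻¹ := by
  rw [inv_pow, ← Complex.ofReal_pow, Real.sq_sqrt zero_le_two, Complex.ofReal_ofNat]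

theorem coe_T₃₀_sq : (T₃₀ ^ 2).1 = !![0, -1; 1, 0] := by
  rw [Matrix.SpecialLinearGroup.coe_pow, coe_T₃₀, smul_pow, inv_sqrt_two_sq, sq]
  ext i j
  fin_cases i <;> fin_cases j <;> norm_num

theorem T₁₁_mem : T₁₁ ∈ binaryOctahedral := Subgroup.subset_closure (by simp)

theorem T₃₀_mem : T₃₀ ∈ binaryOctahedral := Subgroup.subset_closure (by simp)

theorem binaryOctahedral_le_stabilizer : binaryOctahedral ≤ octahedralStabilizer := by
  rw [binaryOctahedral, Subgroup.closure_le]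
  rintro A (rfl | rfl)
  · refine ⟨-1, (subst_octahedralForm_eq_smul_iff _ _).2 fun u v => ?_⟩
    have h4 : xi ^ 4 = -1 :=
      (xi_primitive.pow (by norm_num) (show 8 = 4 * 2 by norm_num)).eq_neg_one_of_two_right
    have hdet : xi * xi⁻¹ = 1 := mul_inv_cancel₀ xi_ne_zero
    simp only [coe_T₁₁, Matrix.diagonal_fin_two, Matrix.of_apply, Matrix.cons_val',
      Matrix.cons_val_zero, Matrix.cons_val_one, Matrix.cons_val_fin_one, zero_mul, add_zero,
      zero_add, Units.val_neg,
      Units.val_one, mul_pow, inv_pow, h4]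
    linear_combination (u * v * (v ^ 4 - u ^ 4)) * hdet
  · refine ⟨-1, (subst_octahedralForm_eq_smul_iff _ _).2 fun u v => ?_⟩
    have h6 : ((Real.sqrt 2 : ℂ)⁻¹) ^ 6 = 8⁻¹ := by
      have hcube := congrArg (· ^ 3) inv_sqrt_two_sq
      norm_num [← pow_mul] at hcube ⊢
      exact hcube
    simp only [coe_T₃₀, Matrix.smul_apply, smul_eq_mul, Matrix.of_apply, Matrix.cons_val',
      Matrix.cons_val_zero, Matrix.cons_val_one, Matrix.cons_val_fin_one, Units.val_neg,
      Units.val_one]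
    linear_combination (-8 * (u * v * (u ^ 4 - v ^ 4))) * h6

theorem mem_zpowers_T₁₁_of_entry_eq_zero {A : SL(2, ℂ)} (hA : A ∈ octahedralStabilizer)
    (h10 : A.1 1 0 = 0) : A ∈ Subgroup.zpowers T₁₁ := by
  obtain ⟨ε, hε⟩ := hA
  rw [subst_octahedralForm_eq_smul_iff] at hε
  have hdet := A.2
  rw [Matrix.det_fin_two, h10, mul_zero, sub_zero] at hdet
  simp only [h10, zero_mul, zero_add] at hε
  have h00 : A.1 0 0 ≠ 0 := left_ne_zero_of_mul_eq_one hdet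
  -- five values determine the coefficient of `u⁴v²`, which does not occur in `uv(u⁴ - v⁴)`
  have h01 : A.1 0 1 = 0 := by
    have hcoeff : 5 * (A.1 0 0 ^ 3 * (A.1 0 0 * A.1 1 1)) * A.1 0 1 = 0 := by
      linear_combination (1 / 4) * hε 0 1 - (1 / 6) * (hε 1 1 + hε (-1) 1) +
        (1 / 24) * (hε 2 1 + hε (-2) 1)
    rw [hdet, mul_one] at hcoeff
    exact (mul_eq_zero.1 hcoeff).resolve_left (mul_ne_zero (by norm_num) (pow_ne_zero 3 h00))
  have h8 : A.1 0 0 ^ 8 = 1 := by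
    have h44 : A.1 0 0 ^ 4 = A.1 1 1 ^ 4 := by
      have h11 := hε 1 1
      rw [h01] at h11
      linear_combination h11 - (A.1 0 0 ^ 4 - A.1 1 1 ^ 4) * hdet
    calc A.1 0 0 ^ 8 = A.1 0 0 ^ 4 * A.1 1 1 ^ 4 := by rw [← h44]; ring
      _ = 1 := by rw [← mul_pow, hdet, one_pow]
  obtain ⟨k, -, hk⟩ := xi_primitive.eq_pow_of_pow_eq_one h8
  refine Subgroup.mem_zpowers_iff.2 ⟨k, ?_⟩
  rw [zpow_natCast]
  refine Subtype.ext ?_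
  rw [coe_T₁₁_pow, hk, ← eq_inv_of_mul_eq_one_right hdet]
  conv_rhs => rw [Matrix.eta_fin_two A.1, h01, h10]

theorem exists_finite_mul_mem_zpowers_T₁₁ : ∃ R : Set SL(2, ℂ), R.Finite ∧
    R ⊆ binaryOctahedral ∧
    ∀ A ∈ octahedralStabilizer, ∃ r ∈ R, r * A ∈ Subgroup.zpowers T₁₁ := by
  refine ⟨{1, T₃₀ ^ 2} ∪ Set.range fun j : Fin 4 => T₃₀⁻¹ * T₁₁ ^ (j : ℕ),
    (Set.toFinite _).union (Set.finite_range _), ?_, fun A hA => ?_⟩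
  · rintro r ((rfl | rfl) | ⟨j, rfl⟩)
    exacts [one_mem _, pow_mem T₃₀_mem 2, mul_mem (inv_mem T₃₀_mem) (pow_mem T₁₁_mem _)]
  have hroot : A.1 0 0 * A.1 1 0 * (A.1 0 0 ^ 4 - A.1 1 0 ^ 4) = 0 := by
    obtain ⟨ε, hε⟩ := hA
    linear_combination (subst_octahedralForm_eq_smul_iff _ _).1 hε 1 0
  have hT₁₁ := binaryOctahedral_le_stabilizer T₁₁_mem
  have hT₃₀ := binaryOctahedral_le_stabilizer T₃₀_mem
  rcases mul_eq_zero.1 hroot with h | h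
  · rcases mul_eq_zero.1 h with h00 | h10
    · refine ⟨T₃₀ ^ 2, by simp, mem_zpowers_T₁₁_of_entry_eq_zero (mul_mem (pow_mem hT₃₀ 2) hA) ?_⟩
      rw [Matrix.SpecialLinearGroup.coe_mul, coe_T₃₀_sq]
      simp [Matrix.mul_apply, h00]
    · exact ⟨1, by simp, mem_zpowers_T₁₁_of_entry_eq_zero (mul_mem (one_mem _) hA)
        (by rwa [one_mul])⟩
  rcases eq_or_ne (A.1 1 0) 0 with h10 | h10
  · exact ⟨1, by simp, mem_zpowers_T₁₁_of_entry_eq_zero (mul_mem (one_mem _) hA)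
      (by rwa [one_mul])⟩
  have h4 : A.1 0 0 ^ 4 = A.1 1 0 ^ 4 := sub_eq_zero.1 h
  have h00 : A.1 0 0 ≠ 0 := fun h00 => h10 (pow_eq_zero_iff four_ne_zero |>.1 (by simp [← h4, h00]))
  have hprim : IsPrimitiveRoot (xi ^ 2) 4 := xi_primitive.pow (by norm_num) (by norm_num)
  obtain ⟨j, hj, hj'⟩ := hprim.eq_pow_of_pow_eq_one (ξ := A.1 1 0 / A.1 0 0) (by
    rw [div_pow, h4, div_self (pow_ne_zero _ h10)])
  refine ⟨T₃₀⁻¹ * T₁₁ ^ j, Or.inr ⟨⟨j, hj⟩, rfl⟩, mem_zpowers_T₁₁_of_entry_eq_zero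
    (mul_mem (mul_mem (inv_mem hT₃₀) (pow_mem hT₁₁ j)) hA) ?_⟩
  have hrel : (xi ^ j)⁻¹ * A.1 1 0 = xi ^ j * A.1 0 0 := by
    rw [inv_mul_eq_iff_eq_mul₀ (pow_ne_zero j xi_ne_zero), ← mul_assoc, ← sq, pow_right_comm, hj',
      div_mul_cancel₀ _ h00]
  rw [mul_assoc, Matrix.SpecialLinearGroup.coe_mul, Matrix.SpecialLinearGroup.coe_mul,
    coe_T₁₁_pow, Matrix.SpecialLinearGroup.coe_inv, coe_T₃₀, Matrix.adjugate_smul,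
    Matrix.adjugate_fin_two_of]
  simp only [Matrix.mul_apply, Fin.sum_univ_two]
  simp [hrel]

theorem binaryOctahedral_eq_stabilizer : binaryOctahedral = octahedralStabilizer := by
  refine le_antisymm binaryOctahedral_le_stabilizer fun A hA => ?_
  obtain ⟨R, -, hR, hmul⟩ := exists_finite_mul_mem_zpowers_T₁₁
  obtain ⟨r, hr, hrA⟩ := hmul A hA
  exact (mul_mem_cancel_left (hR hr)).1 (Subgroup.zpowers_le.2 T₁₁_mem hrA)

theorem isOfFinOrder_T₁₁ : IsOfFinOrder T₁₁ := by
  refine isOfFinOrder_iff_pow_eq_one.2 ⟨8, by norm_num, Subtype.ext ?_⟩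
  rw [coe_T₁₁_pow, xi_primitive.pow_eq_one, inv_one, ← Matrix.one_fin_two]
  rfl

instance finite_binaryOctahedral : Finite binaryOctahedral := by
  obtain ⟨R, hfin, -, hmul⟩ := exists_finite_mul_mem_zpowers_T₁₁
  have hzpowers : (Subgroup.zpowers T₁₁ : Set SL(2, ℂ)).Finite :=
    finite_zpowers.2 isOfFinOrder_T₁₁
  refine ((hfin.inv.mul hzpowers).subset fun A hA => ?_).to_subtype
  obtain ⟨r, hr, hrA⟩ := hmul A (binaryOctahedral_le_stabilizer hA)
  exact ⟨r⁻¹, Set.inv_mem_inv.2 hr, r * A, hrA, inv_mul_cancel_left r A⟩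

theorem transpose_mem_binaryOctahedral {A : SL(2, ℂ)} (hA : A ∈ binaryOctahedral) :
    A.transpose ∈ binaryOctahedral := by
  have hconj : A.transpose = T₃₀ ^ 2 * A⁻¹ * (T₃₀ ^ 2)⁻¹ := by
    refine Subtype.ext ?_
    rw [Matrix.SpecialLinearGroup.coe_mul, Matrix.SpecialLinearGroup.coe_mul,
      Matrix.SpecialLinearGroup.coe_inv, Matrix.SpecialLinearGroup.coe_inv, coe_T₃₀_sq]
    ext i j
    fin_cases i <;> fin_cases j <;> simp [Matrix.mul_apply, Matrix.adjugate_fin_two]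
  rw [hconj]
  exact mul_mem (mul_mem (pow_mem T₃₀_mem 2) (inv_mem hA)) (inv_mem (pow_mem T₃₀_mem 2))

theorem exists_eq_smul_coe {K ι : Type*} [Field K] [IsAlgClosed K] [Fintype ι] [DecidableEq ι]
    [Nonempty ι] {A : Matrix ι ι K} (hA : A.det ≠ 0) :
    ∃ a : K, a ≠ 0 ∧ ∃ A' : Matrix.SpecialLinearGroup ι K, A = a • A'.1 := by
  obtain ⟨a, ha⟩ := IsAlgClosed.exists_pow_nat_eq A.det (Fintype.card_pos (α := ι))
  have ha0 : a ≠ 0 := by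
    rintro rfl
    exact hA (by rw [← ha, zero_pow Fintype.card_ne_zero])
  refine ⟨a, ha0, ⟨a⁻¹ • A, ?_⟩, (smul_inv_smul₀ ha0 A).symm⟩
  rw [Matrix.det_smul, ← ha, inv_pow, inv_mul_cancel₀ (pow_ne_zero _ ha0)]

theorem subst_formRep {m : ℕ} (A B : SL(2, ℂ)) (p : V m) :
    subst B.1 (formRep m A p).1 = subst (A⁻¹ * B).1 p.1 := by
  rw [Matrix.SpecialLinearGroup.coe_mul, subst_mul]
  rfl

theorem exists_smul_mul_of_f₁_eq_smul {A B : Matrix (Fin 2) (Fin 2) ℂ} (hA : A.det ≠ 0)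
    (hB : B.det ≠ 0) {k : ℂ} (h : f₁ B = k • f₁ A) :
    ∃ s ∈ binaryOctahedral, ∃ c : ℂ, c ≠ 0 ∧ B = c • (A * s.1) := by
  obtain ⟨a, ha, A, rfl⟩ := exists_eq_smul_coe hA
  obtain ⟨b, hb, B, rfl⟩ := exists_eq_smul_coe hB
  obtain ⟨l, hl⟩ : ∃ l : ℂ, f₁ B.1 = l • f₁ A.1 := by
    refine ⟨(b ^ 6)⁻¹ * (k * a ^ 6), ?_⟩
    rw [f₁_smul, f₁_smul, smul_smul] at h
    rw [mul_smul, ← h, inv_smul_smul₀ (pow_ne_zero 6 hb)]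
  have hforms : (formRep 6 B octahedralForm).1 = l • (formRep 6 A octahedralForm).1 :=
    sexticCoord_injOn (Subtype.prop _) (Submodule.smul_mem _ _ (Subtype.prop _)) (by
      rw [isLinearMap_sexticCoord.map_smul, ← f₁_coe, ← f₁_coe, hl])
  have hoct : octahedralForm.1 = l • subst (A⁻¹ * B).1 octahedralForm.1 := by
    have := congrArg (subst B.1) hforms
    rwa [map_smul, subst_formRep, subst_formRep, inv_mul_cancel, Matrix.SpecialLinearGroup.coe_one,
      subst_one] at this
  have hl0 : l ≠ 0 := by
    rintro rfl
    exact octahedralForm_ne_zero (by rw [hoct, zero_smul])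
  refine ⟨A⁻¹ * B, ?_, b / a, div_ne_zero hb ha, ?_⟩
  · rw [binaryOctahedral_eq_stabilizer]
    exact ⟨(Units.mk0 l hl0)⁻¹, (inv_smul_eq_iff₀ hl0).2 hoct |>.symm⟩
  · rw [Matrix.smul_mul, ← Matrix.SpecialLinearGroup.coe_mul, mul_inv_cancel_left, smul_smul,
      div_mul_cancel₀ _ ha]

theorem exists_f₁_mul_eq_smul {s : SL(2, ℂ)} (hs : s ∈ binaryOctahedral) :
    ∃ ε : ℂ, ∀ A : Matrix (Fin 2) (Fin 2) ℂ, f₁ (A * s.1) = ε • f₁ A := by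
  obtain ⟨ε, hε⟩ := binaryOctahedral_le_stabilizer (inv_mem hs)
  refine ⟨ε.1, fun A => ?_⟩
  rw [f₁, Matrix.adjugate_mul_distrib, ← Matrix.SpecialLinearGroup.coe_inv, subst_mul,
    AlgHom.comp_apply, hε, map_smul, isLinearMap_sexticCoord.map_smul, f₁]

theorem exists_forall_eq_sum_eval {σ K : Type*} [Finite σ] [Field K] [Infinite K] {m : ℕ}
    (ℓ : Module.Dual K (homogeneousSubmodule σ K m)) :
    ∃ c : (σ → K) →₀ K, ∀ p, ℓ p = c.sum fun x a => a * eval x p.1 := by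
  have : Module.Finite K (homogeneousSubmodule σ K m) :=
    Module.Finite.iff_fg.2 (homogeneousSubmodule_fg σ K m)
  let ev (x : σ → K) : Module.Dual K (homogeneousSubmodule σ K m) :=
    (aeval x).toLinearMap ∘ₗ (homogeneousSubmodule σ K m).subtype
  have hspan : Submodule.span K (Set.range ev) = ⊤ := by
    rw [← Subspace.dualCoannihilator_dualAnnihilator_eq (W := Submodule.span K (Set.range ev)),
      Submodule.dualAnnihilator_eq_top_iff]
    refine (Submodule.eq_bot_iff _).2 fun p hp => Subtype.ext (MvPolynomial.funext fun x => ?_)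
    exact (Submodule.mem_dualCoannihilator _).1 hp _ (Submodule.subset_span ⟨x, rfl⟩)
  obtain ⟨c, rfl⟩ := Finsupp.mem_span_range_iff_exists_finsupp.1
    (hspan ▸ Submodule.mem_top (x := ℓ))
  exact ⟨c, fun p => by simp [Finsupp.sum, ev, aeval_eq_eval]⟩

theorem exists_eval_eq_dual_subst {m n : ℕ} (p : V m) (ℓ : Module.Dual ℂ (V m))
    {B : Matrix (Fin 2) (Fin 2) (MvPolynomial (Fin 2) ℂ)} (hB : ∀ i j, B i j ∈ V n) :
    ∃ ψ ∈ V (n * m), ∀ x,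
      eval x ψ = ℓ ⟨subst (B.map (eval x)) p, subst_mem _ p.2⟩ := by
  obtain ⟨c, hc⟩ := exists_forall_eq_sum_eval ℓ
  refine ⟨c.sum fun z a => C a * aeval (fun i => ∑ j, B i j * C (z j)) p.1, ?_, fun x => ?_⟩
  · refine Submodule.sum_mem _ fun z _ => IsHomogeneous.C_mul (IsHomogeneous.aeval p.2 _ ?_) _
    exact fun i => IsHomogeneous.sum _ _ _ fun j _ => by
      simpa using IsHomogeneous.mul (hB i j) (isHomogeneous_C _ (z j))
  · rw [hc, Finsupp.sum, map_sum]
    refine Finset.sum_congr rfl fun z _ => ?_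
    have hcomp : (aeval x).comp (aeval fun i => ∑ j, B i j * C (z j)) =
        (aeval ((B.map (eval x)).mulVec z) : MvPolynomial (Fin 2) ℂ →ₐ[ℂ] ℂ) := by
      rw [comp_aeval]
      congr 1
      funext i
      simp [Matrix.mulVec, dotProduct, aeval_eq_eval]
    dsimp only
    rw [map_mul, eval_C, eval_subst]
    exact congrArg _ (DFunLike.congr_fun hcomp p.1)

theorem exists_eval_eq_f₁_formMatrix {n : ℕ} (a b c e : V n) :
    ∃ ψ : Fin 7 → MvPolynomial (Fin 2) ℂ, (∀ i, ψ i ∈ V (n * 6)) ∧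
      ∀ x i, eval x (ψ i) = f₁ (formMatrix a b c e x) i := by
  let coord (i : Fin 7) : Module.Dual ℂ (V 6) :=
    LinearMap.proj i ∘ₗ isLinearMap_sexticCoord.mk' _ ∘ₗ (V 6).subtype
  have hadj : ∀ i j, !![e.1, -b.1; -c.1, a.1] i j ∈ V n :=
    Fin.forall_fin_two.2 ⟨Fin.forall_fin_two.2 ⟨e.2, neg_mem b.2⟩,
      Fin.forall_fin_two.2 ⟨neg_mem c.2, a.2⟩⟩
  choose ψ hψ heval using fun i => exists_eval_eq_dual_subst octahedralForm (coord i) hadj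
  refine ⟨ψ, hψ, fun x i => (heval i x).trans ?_⟩
  have hmap : !![e.1, -b.1; -c.1, a.1].map (eval x) = (formMatrix a b c e x).adjugate := by
    rw [formMatrix, Matrix.adjugate_fin_two_of]
    ext i j
    fin_cases i <;> fin_cases j <;> simp
  simp only [hmap, coord, f₁, LinearMap.comp_apply, IsLinearMap.mk'_apply, LinearMap.proj_apply,
    Submodule.subtype_apply]

end Octahedral

/-! ### Morphisms and coverings of the projective line -/

section Morphisms

theorem mk_eq_mk_iff_mul_eq {K ι : Type*} [Field K] {v w : ι → K} (hv : v ≠ 0) (hw : w ≠ 0) :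
    Projectivization.mk K v hv = Projectivization.mk K w hw ↔ ∀ i j, v i * w j = v j * w i := by
  rw [Projectivization.mk_eq_mk_iff']
  constructor
  · rintro ⟨c, rfl⟩ i j
    simp only [Pi.smul_apply, smul_eq_mul]
    ring
  · intro h
    obtain ⟨j, hj⟩ := Function.ne_iff.1 hw
    refine ⟨v j / w j, funext fun i => ?_⟩
    rw [Pi.smul_apply, smul_eq_mul, div_mul_eq_mul_div, div_eq_iff hj, h i j]

/-- The map `F` to a projective space is given in homogeneous coordinates by the polynomials `p`,
which therefore have no common nontrivial zero. -/
def IsGivenByForms {k : ℕ} (F : P1 → ℙ ℂ (Fin k → ℂ)) (p : Fin k → MvPolynomial (Fin 2) ℂ) :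
    Prop :=
  ∀ (x : Fin 2 → ℂ) (hx : x ≠ 0), ∃ h : (fun i => eval x (p i)) ≠ 0,
    F (Projectivization.mk ℂ x hx) = Projectivization.mk ℂ (fun i => eval x (p i)) h

theorem IsGivenByForms.isBasePointFree {k : ℕ} {F : P1 → ℙ ℂ (Fin k → ℂ)}
    {p : Fin k → MvPolynomial (Fin 2) ℂ} (hF : IsGivenByForms F p) : IsBasePointFree p :=
  fun y hy => Function.ne_iff.1 (hF y hy).1

theorem IsMorphismOfDegree.exists_isGivenByForms {k m : ℕ} {F : P1 → ℙ ℂ (Fin k → ℂ)}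
    (hF : IsMorphismOfDegree m F) :
    ∃ p : Fin k → MvPolynomial (Fin 2) ℂ, (∀ i, p i ∈ V m) ∧ IsGivenByForms F p := by
  obtain ⟨Φ, hΦ, hF⟩ := hF
  choose p hp heval using fun i => hΦ (LinearMap.proj i)
  have hΦp (x) : Φ x = fun i => eval x (p i) := funext fun i => heval i x
  refine ⟨p, hp, fun x hx => ?_⟩
  rw [← hΦp]
  exact hF x hx

theorem exists_isMorphismOfDegree {E : Type*} [AddCommGroup E] [Module ℂ E] {m : ℕ}
    (Φ : (Fin 2 → ℂ) → E) (hΦ : ∀ ℓ : Module.Dual ℂ E, ∃ p ∈ V m, ∀ x, ℓ (Φ x) = eval x p)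
    (h0 : ∀ x, x ≠ 0 → Φ x ≠ 0) :
    ∃ F : P1 → ℙ ℂ E, IsMorphismOfDegree m F ∧ ∀ (x : Fin 2 → ℂ) (hx : x ≠ 0),
      F (Projectivization.mk ℂ x hx) = Projectivization.mk ℂ (Φ x) (h0 x hx) := by
  have hsmul (c : ℂ) (x) : Φ (c • x) = c ^ m • Φ x := by
    rw [← sub_eq_zero, ← Module.forall_dual_apply_eq_zero_iff ℂ]
    intro ℓ
    obtain ⟨p, hp, heval⟩ := hΦ ℓ
    rw [map_sub, map_smul, heval, heval, eval_smul_of_isHomogeneous hp, smul_eq_mul, sub_self]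
  let F (q : P1) : ℙ ℂ E := Projectivization.mk ℂ (Φ q.rep) (h0 _ q.rep_nonzero)
  have hF (x : Fin 2 → ℂ) (hx : x ≠ 0) :
      F (Projectivization.mk ℂ x hx) = Projectivization.mk ℂ (Φ x) (h0 x hx) := by
    obtain ⟨a, ha⟩ := Projectivization.exists_smul_eq_mk_rep ℂ x hx
    exact (Projectivization.mk_eq_mk_iff' ..).2 ⟨(a : ℂ) ^ m, by rw [← hsmul, ← ha]; rfl⟩
  exact ⟨F, ⟨Φ, hΦ, fun x hx => ⟨h0 x hx, hF x hx⟩⟩, hF⟩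

theorem exists_form_of_dual {ι E : Type*} [Finite ι] [AddCommGroup E] [Module ℂ E] {m : ℕ}
    (b : Module.Basis ι ℂ E) {Φ : (Fin 2 → ℂ) → E} {p : ι → MvPolynomial (Fin 2) ℂ}
    (hp : ∀ i, p i ∈ V m) (heval : ∀ x i, b.repr (Φ x) i = eval x (p i)) (ℓ : Module.Dual ℂ E) :
    ∃ q ∈ V m, ∀ x, ℓ (Φ x) = eval x q :=
  have := Fintype.ofFinite ι
  ⟨∑ i, ℓ (b i) • p i, Submodule.sum_mem _ fun i _ => Submodule.smul_mem _ _ (hp i), fun x => by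
    rw [← b.sum_repr (Φ x), map_sum, map_sum]
    refine Finset.sum_congr rfl fun i _ => ?_
    rw [map_smul, smul_eval, heval, smul_eq_mul, mul_comm]⟩

theorem mulVec_ne_zero (t : SL(2, ℂ)) {x : Fin 2 → ℂ} (hx : x ≠ 0) : t.1.mulVec x ≠ 0 :=
  (smul_ne_zero_iff_ne t).mpr hx

theorem moebius_mk (t : SL(2, ℂ)) (x : Fin 2 → ℂ) (hx : x ≠ 0) :
    moebius t (Projectivization.mk ℂ x hx) =
      Projectivization.mk ℂ (t.1.mulVec x) (mulVec_ne_zero t hx) :=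
  rfl

theorem mulVec_inv_mulVec (t : SL(2, ℂ)) (x : Fin 2 → ℂ) :
    t.1.mulVec ((t⁻¹ : SL(2, ℂ)).1.mulVec x) = x :=
  smul_inv_smul t x

theorem eq_one_or_neg_one_of_coe_eq_smul_one {K : Type*} [Field K] {t : SL(2, K)} {c : K}
    (h : t.1 = c • 1) : t = 1 ∨ t = -1 := by
  have hdet := t.2
  rw [h, Matrix.det_smul, Matrix.det_one, mul_one, Fintype.card_fin, sq] at hdet
  rcases mul_self_eq_one_iff.1 hdet with rfl | rfl
  · exact Or.inl (Subtype.ext (by rw [h, one_smul, Matrix.SpecialLinearGroup.coe_one]))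
  · exact Or.inr (Subtype.ext (by
      rw [h, neg_one_smul, Matrix.SpecialLinearGroup.coe_neg, Matrix.SpecialLinearGroup.coe_one]))

theorem eq_one_or_neg_one_of_forall_eval_wedge_eq_zero {K : Type*} [Field K] {t : SL(2, K)}
    (h : ∀ y : Fin 2 → K, eval (t.1.mulVec y) (wedge y) = 0) : t = 1 ∨ t = -1 := by
  simp only [eval_wedge, Matrix.mulVec, dotProduct, Fin.sum_univ_two] at h
  have h10 : t.1 1 0 = 0 := by simpa using h ![1, 0]
  have h01 : t.1 0 1 = 0 := by simpa using h ![0, 1]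
  have h11 : t.1 0 0 - t.1 1 1 = 0 := by simpa [h10, h01] using h ![1, 1]
  refine eq_one_or_neg_one_of_coe_eq_smul_one (c := t.1 0 0) ?_
  ext i j
  fin_cases i <;> fin_cases j <;> simp [h10, h01, (sub_eq_zero.1 h11).symm]

theorem eq_one_or_neg_one_of_moebius_eq_one {t : SL(2, ℂ)} (h : moebius t = 1) :
    t = 1 ∨ t = -1 := by
  refine eq_one_or_neg_one_of_forall_eval_wedge_eq_zero fun y => ?_
  rcases eq_or_ne y 0 with rfl | hy
  · simp only [eval_wedge, Pi.zero_apply, zero_mul, sub_zero]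
  have hfix := moebius_mk t y hy
  rw [h, Equiv.Perm.one_apply, mk_eq_mk_iff_mul_eq] at hfix
  rw [eval_wedge, hfix 1 0, sub_self]

theorem moebius_neg_one : moebius (-1) = 1 := by
  ext q
  induction q using Projectivization.ind with
  | h x hx =>
    rw [moebius_mk, Equiv.Perm.one_apply, Projectivization.mk_eq_mk_iff']
    exact ⟨-1, by rw [Matrix.SpecialLinearGroup.coe_neg, Matrix.SpecialLinearGroup.coe_one,
      Matrix.neg_mulVec, Matrix.one_mulVec, neg_one_smul]⟩

theorem moebius_eq_moebius_iff {t t' : SL(2, ℂ)} :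
    moebius t = moebius t' ↔ t = t' ∨ t = -t' := by
  constructor
  · intro h
    have h1 : moebius (t * t'⁻¹) = 1 := by rw [map_mul, map_inv, h, mul_inv_cancel]
    refine (eq_one_or_neg_one_of_moebius_eq_one h1).imp mul_inv_eq_one.1 fun h2 => ?_
    rw [mul_inv_eq_iff_eq_mul.1 h2, neg_one_mul]
  · rintro (rfl | rfl)
    · rfl
    · rw [← neg_one_mul, map_mul, moebius_neg_one, one_mul]

theorem neg_one_mem_binaryGroup (G : Subgroup (Equiv.Perm P1)) : -1 ∈ binaryGroup G := by
  refine ⟨(Matrix.mem_unitaryGroup_iff (A := -1)).2 (by simp), ?_⟩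
  change moebius (-1) ∈ G
  rw [moebius_neg_one]
  exact one_mem G

theorem finite_binaryGroup (G : Subgroup (Equiv.Perm P1)) [Finite G] : Finite (binaryGroup G) := by
  have hfin : (moebius ⁻¹' (G : Set (Equiv.Perm P1))).Finite := by
    refine (Set.toFinite _).preimage' fun σ _ => ?_
    rcases (moebius ⁻¹' {σ}).eq_empty_or_nonempty with h | ⟨t, rfl⟩
    · exact h ▸ Set.finite_empty
    · exact (Set.toFinite {t, -t}).subset fun t' ht' => moebius_eq_moebius_iff.1 ht'
  exact (hfin.subset fun t ht => ht.2).to_subtype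

theorem apply_moebius_of_mem {φ : P1 → P1} {t : SL(2, ℂ)} (ht : t ∈ binaryGroup (deckGroup φ))
    (p : P1) : φ (moebius t p) = φ p :=
  ht.2.2 p

theorem IsMorphismOfDegree.surjective {d : ℕ} (hd : 0 < d) {φ : P1 → P1}
    (hφ : IsMorphismOfDegree d φ) : Function.Surjective φ := by
  intro q
  induction q using Projectivization.ind with
  | h y hy =>
    obtain ⟨p, hp, hφp⟩ := hφ.exists_isGivenByForms
    have hform : y 1 • p 0 - y 0 • p 1 ∈ V d :=
      sub_mem (Submodule.smul_mem _ _ (hp 0)) (Submodule.smul_mem _ _ (hp 1))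
    obtain ⟨x, hx, hx0⟩ := exists_eval_eq_zero_of_pos hd hform
    obtain ⟨h, hφx⟩ := hφp x hx
    refine ⟨Projectivization.mk ℂ x hx, hφx.trans ((mk_eq_mk_iff_mul_eq h hy).2 ?_)⟩
    rw [map_sub, smul_eval, smul_eval] at hx0
    simp only [Fin.forall_fin_two, mul_comm, true_and, and_true]
    exact ⟨by linear_combination hx0, by linear_combination -hx0⟩

theorem IsGivenByForms.exists_subst_eq_C_mul {d : ℕ} {φ : P1 → P1}
    {p : Fin 2 → MvPolynomial (Fin 2) ℂ} (hφ : IsGivenByForms φ p) (hp : ∀ i, p i ∈ V d)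
    {t : SL(2, ℂ)} (ht : t ∈ binaryGroup (deckGroup φ)) :
    ∃ c : ℂ, c ≠ 0 ∧ ∀ i, subst t.1 (p i) = C c * p i := by
  obtain ⟨c, hc⟩ := hφ.isBasePointFree.exists_eq_C_mul (p := fun i => subst t.1 (p i))
    (fun i => subst_mem _ (hp i)) hp (by
      refine fun i j => MvPolynomial.funext fun x => ?_
      simp only [map_mul, eval_subst]
      rcases eq_or_ne x 0 with rfl | hx
      · simp [mul_comm]
      obtain ⟨h, hφx⟩ := hφ x hx
      obtain ⟨ht', hφtx⟩ := hφ _ (mulVec_ne_zero t hx)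
      rw [← moebius_mk t x hx, apply_moebius_of_mem ht, hφx, mk_eq_mk_iff_mul_eq] at hφtx
      linear_combination -hφtx i j)
  refine ⟨c, ?_, hc⟩
  rintro rfl
  have hx : (![1, 0] : Fin 2 → ℂ) ≠ 0 := fun h => one_ne_zero (congrFun h 0)
  obtain ⟨i, hi⟩ := hφ.isBasePointFree _ (mulVec_ne_zero t hx)
  exact hi (by rw [← eval_subst, hc i, C_0, zero_mul, map_zero])

end Morphisms

/-! ### Lifting an isomorphism modulo signs -/

section Lifting

variable {F : Type*} [Field F]

theorem mem_center_iff_eq_one_or_neg_one {t : SL(2, F)} :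
    t ∈ Subgroup.center SL(2, F) ↔ t = 1 ∨ t = -1 := by
  constructor
  · intro ht
    obtain ⟨c, -, hc⟩ := Matrix.SpecialLinearGroup.mem_center_iff.1 ht
    refine eq_one_or_neg_one_of_coe_eq_smul_one (c := c) ?_
    rw [← hc, Matrix.scalar_apply, Matrix.smul_one_eq_diagonal]
  · rintro (rfl | rfl)
    · exact one_mem _
    · exact Subgroup.mem_center_iff.2 fun s => by rw [mul_neg_one, neg_one_mul]

theorem sq_eq_trace_smul_sub_one (t : SL(2, F)) :
    (t ^ 2).1 = t.1.trace • t.1 - (1 : Matrix (Fin 2) (Fin 2) F) := by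
  have hcayley := Matrix.aeval_self_charpoly t.1
  rw [Matrix.charpoly_fin_two, t.2] at hcayley
  simp only [map_add, map_sub, map_mul, map_pow, Polynomial.aeval_X, Polynomial.aeval_C,
    map_one, ← Algebra.smul_def] at hcayley
  rw [Matrix.SpecialLinearGroup.coe_pow, eq_sub_iff_add_eq, ← sub_eq_zero, ← hcayley]
  abel

theorem sq_eq_neg_one_of_trace_eq_zero {t : SL(2, F)} (h : t.1.trace = 0) : t ^ 2 = -1 :=
  Subtype.ext (by rw [sq_eq_trace_smul_sub_one, h, zero_smul, zero_sub,
    Matrix.SpecialLinearGroup.coe_neg, Matrix.SpecialLinearGroup.coe_one])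

theorem commute_of_notMem_center {s s' z : SL(2, F)} (hz : z ∉ Subgroup.center SL(2, F))
    (h : Commute s z) (h' : Commute s' z) : Commute s s' := by
  -- two matrices commute if and only if their traceless parts are parallel
  let v (t : SL(2, F)) : Fin 3 → F := ![t.1 0 1, t.1 1 0, t.1 0 0 - t.1 1 1]
  have hcomm (t t' : SL(2, F)) : Commute t t' ↔ ∀ i j, v t i * v t' j = v t j * v t' i := by
    simp only [commute_iff_eq, Matrix.SpecialLinearGroup.ext_iff,
      Matrix.SpecialLinearGroup.coe_mul, Fin.forall_fin_succ, Matrix.mul_apply, Fin.sum_univ_two,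
      v, Matrix.cons_val_zero, Matrix.cons_val_succ, Matrix.cons_val_fin_one, IsEmpty.forall_iff,
      and_true, Fin.succ_zero_eq_one]
    constructor <;> intro h <;> grind
  have hvz : v z ≠ 0 := by
    refine fun h0 => hz (mem_center_iff_eq_one_or_neg_one.2
      (eq_one_or_neg_one_of_coe_eq_smul_one (c := z.1 0 0) ?_))
    have h01 : z.1 0 1 = 0 := congrFun h0 0
    have h10 : z.1 1 0 = 0 := congrFun h0 1
    have h11 : z.1 1 1 = z.1 0 0 := (sub_eq_zero.1 (congrFun h0 2)).symm
    ext i j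
    fin_cases i <;> fin_cases j <;> simp [h01, h10, h11]
  obtain ⟨k, hk⟩ := Function.ne_iff.1 hvz
  rw [hcomm] at h h' ⊢
  have hpar {t : SL(2, F)} (h : ∀ i j, v t i * v z j = v t j * v z i) (i : Fin 3) :
      v t i = v t k / v z k * v z i := by
    rw [div_mul_eq_mul_div, eq_div_iff hk, h i k]
  intro i j
  rw [hpar h i, hpar h j, hpar h' i, hpar h' j]
  ring

section LiftingSubgroups

variable [NeZero (2 : F)]

theorem neg_one_ne_one_of_two_ne_zero : (-1 : SL(2, F)) ≠ 1 := by
  intro h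
  have h00 : (-1 : F) = 1 := by simpa using congrArg (fun A : SL(2, F) => A.1 0 0) h
  exact two_ne_zero (α := F) (by linear_combination -h00)

theorem mem_center_of_sq_eq_one {t : SL(2, F)} (h : t ^ 2 = 1) :
    t ∈ Subgroup.center SL(2, F) := by
  have hcayley := sq_eq_trace_smul_sub_one t
  rw [h, Matrix.SpecialLinearGroup.coe_one, eq_sub_iff_add_eq] at hcayley
  have htrace : t.1.trace ≠ 0 := by
    intro h0
    have h00 := congrFun₂ hcayley 0 0
    rw [h0, zero_smul, Matrix.add_apply, Matrix.one_apply_eq, one_add_one_eq_two] at h00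
    exact two_ne_zero h00
  refine mem_center_iff_eq_one_or_neg_one.2
    (eq_one_or_neg_one_of_coe_eq_smul_one (c := t.1.trace⁻¹ * 2) ?_)
  rw [mul_smul, two_smul, hcayley, inv_smul_smul₀ htrace]

theorem sq_eq_neg_one_of_sq_mem_center {t : SL(2, F)} (ht : t ∉ Subgroup.center SL(2, F))
    (h : t ^ 2 ∈ Subgroup.center SL(2, F)) : t ^ 2 = -1 :=
  (mem_center_iff_eq_one_or_neg_one.1 h).resolve_left fun h => ht (mem_center_of_sq_eq_one h)

theorem commute_or_sq_eq_neg_one {s z : SL(2, F)}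
    (h : Commute (s : SL(2, F) ⧸ Subgroup.center SL(2, F)) z) : Commute s z ∨ s ^ 2 = -1 := by
  rcases mem_center_iff_eq_one_or_neg_one.1 (QuotientGroup.eq.1 h) with hsign | hsign
  · exact Or.inl (inv_mul_eq_one.1 hsign)
  · have hanti : z * s * z⁻¹ = -s := by
      have hzs : z * s = s * z * -1 := inv_mul_eq_iff_eq_mul.1 hsign
      rw [hzs, mul_neg_one, neg_mul, mul_inv_cancel_right]
    have htrace : s.1.trace = -s.1.trace := by
      rw [← Matrix.trace_neg, ← Matrix.SpecialLinearGroup.coe_neg, ← hanti,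
        Matrix.SpecialLinearGroup.coe_mul, Matrix.trace_mul_comm,
        ← Matrix.SpecialLinearGroup.coe_mul, ← mul_assoc, inv_mul_cancel, one_mul]
    have h2 : 2 * s.1.trace = 0 := by linear_combination htrace
    exact Or.inr (sq_eq_neg_one_of_trace_eq_zero
      ((mul_eq_zero.1 h2).resolve_left two_ne_zero))

variable {S : Type*} [Group S] {p q : S →* SL(2, F)}

theorem commute_of_commute
    (hpq : ∀ x, p x ∈ Subgroup.center SL(2, F) ↔ q x ∈ Subgroup.center SL(2, F)) {x z : S}
    (hz : p z ^ 2 = -1) (hcomm : Commute (q x : SL(2, F) ⧸ Subgroup.center SL(2, F)) (q z))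
    (h : Commute (p x) (p z)) : Commute (q x) (q z) := by
  by_cases hx : p x ∈ Subgroup.center SL(2, F)
  · exact Subgroup.mem_center_iff.1 ((hpq x).1 hx) (q z) |>.symm
  refine (commute_or_sq_eq_neg_one hcomm).elim id fun hq2 => ?_
  have hp2 : p x ^ 2 = -1 := by
    refine sq_eq_neg_one_of_sq_mem_center hx ?_
    rw [← map_pow, hpq, map_pow, hq2]
    exact mem_center_iff_eq_one_or_neg_one.2 (Or.inr rfl)
  have hdiv : p (x * z⁻¹) ∈ Subgroup.center SL(2, F) := by
    refine mem_center_of_sq_eq_one ?_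
    rw [map_mul, map_inv, h.inv_right.mul_pow, hp2, inv_pow, hz, mul_inv_cancel]
  have hq := Subgroup.mem_center_iff.1 ((hpq _).1 hdiv) (q z)
  rw [map_mul, map_inv, inv_mul_cancel_right, ← mul_assoc] at hq
  exact (mul_inv_eq_iff_eq_mul.1 hq.symm.symm).symm

theorem exists_map_ne_one_of_isPGroup [Finite S] {G : Type*} [Group G] {r : ℕ} [Fact r.Prime]
    (hS : IsPGroup r S) (π : S →* G) {x₀ : S} (h₀ : π x₀ ≠ 1) :
    ∃ z, π z ≠ 1 ∧ π z ^ r = 1 ∧ ∀ x, Commute (π x) (π z) := by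
  have hrange : IsPGroup r π.range := hS.of_surjective π.rangeRestrict π.rangeRestrict_surjective
  have : Nontrivial π.range := ⟨⟨π x₀, x₀, rfl⟩, 1, fun h => h₀ (congrArg Subtype.val h)⟩
  have : Finite π.range := Finite.of_surjective _ π.rangeRestrict_surjective
  have hdvd : r ∣ Nat.card (Subgroup.center π.range) := by
    have := hrange.center_nontrivial
    obtain ⟨n, hn, hcard⟩ := (hrange.to_subgroup _).nontrivial_iff_card.1 this
    exact hcard ▸ dvd_pow_self r hn.ne'
  obtain ⟨⟨⟨-, z, rfl⟩, hcentral⟩, horder⟩ := exists_prime_orderOf_dvd_card' r hdvd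
  rw [orderOf_eq_prime_iff] at horder
  simp only [Subtype.ext_iff, Subgroup.coe_pow, ne_eq, Subgroup.coe_one] at horder
  exact ⟨z, horder.2, horder.1, fun x =>
    congrArg Subtype.val (Subgroup.mem_center_iff.1 hcentral ⟨π x, x, rfl⟩)⟩

theorem exists_subgroup_of_forall_mem_center (hp : ∀ x, p x ∈ Subgroup.center SL(2, F))
    (hq : ∀ x, q x ∈ Subgroup.center SL(2, F)) :
    ∃ K : Subgroup S, (∀ x, x ^ 2 ∈ K) ∧ (∀ x, p x = -1 → q x = -1 → x ∈ K) ∧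
      ∀ x, p x = -1 → q x = 1 → x ∉ K := by
  have hsq {t : SL(2, F)} (ht : t ∈ Subgroup.center SL(2, F)) : t ^ 2 = 1 := by
    rcases mem_center_iff_eq_one_or_neg_one.1 ht with rfl | rfl
    · exact one_pow 2
    · exact neg_one_sq
  refine ⟨(Subgroup.zpowers (-1, -1)).comap (p.prod q), fun x => ?_, fun x hpx hqx => ?_,
    fun x hpx hqx hx => ?_⟩
  · have : p.prod q (x ^ 2) = 1 := by
      rw [map_pow, MonoidHom.prod_apply, Prod.pow_mk, hsq (hp x), hsq (hq x), Prod.mk_one_one]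
    rw [Subgroup.mem_comap, this]
    exact one_mem _
  · rw [Subgroup.mem_comap, MonoidHom.prod_apply, hpx, hqx]
    exact Subgroup.mem_zpowers _
  · rw [Subgroup.mem_comap, MonoidHom.prod_apply, hpx, hqx] at hx
    obtain ⟨n, hn⟩ := Subgroup.mem_zpowers_iff.1 hx
    rw [Prod.pow_mk, Prod.mk.injEq] at hn
    exact neg_one_ne_one_of_two_ne_zero (hn.1.symm.trans hn.2)

theorem exists_subgroup_mem_iff_eq_sq {G : Type*} [Group G] (f : S →* G) (z : S)
    (habel : ∀ x y, Commute (f x) (f z) → Commute (f y) (f z) → Commute (f x) (f y)) :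
    ∃ K : Subgroup S, ∀ x, x ∈ K ↔ ∃ y, Commute (f y) (f z) ∧ f x = f y ^ 2 :=
  ⟨{  carrier := {x | ∃ y, Commute (f y) (f z) ∧ f x = f y ^ 2}
      one_mem' := ⟨1, by rw [map_one]; exact Commute.one_left _, by rw [map_one, one_pow]⟩
      mul_mem' := by
        rintro x x' ⟨y, hy, hx⟩ ⟨y', hy', hx'⟩
        exact ⟨y * y', by rw [map_mul]; exact hy.mul_left hy', by
          rw [map_mul, map_mul, hx, hx', (habel y y' hy hy').mul_pow]⟩
      inv_mem' := by
        rintro x ⟨y, hy, hx⟩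
        exact ⟨y⁻¹, by rw [map_inv]; exact hy.inv_left, by rw [map_inv, map_inv, hx, inv_pow]⟩ },
    fun _ => Iff.rfl⟩

theorem exists_subgroup_of_notMem_center
    (hpq : ∀ x, p x ∈ Subgroup.center SL(2, F) ↔ q x ∈ Subgroup.center SL(2, F)) {z : S}
    (hz : p z ∉ Subgroup.center SL(2, F)) (hpz : p z ^ 2 = -1) (hqz : q z ^ 2 = -1)
    (hp : ∀ x, Commute (p x : SL(2, F) ⧸ Subgroup.center SL(2, F)) (p z))
    (hq : ∀ x, Commute (q x : SL(2, F) ⧸ Subgroup.center SL(2, F)) (q z)) :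
    ∃ K : Subgroup S, (∀ x, x ^ 2 ∈ K) ∧ (∀ x, p x = -1 → q x = -1 → x ∈ K) ∧
      ∀ x, p x = -1 → q x = 1 → x ∉ K := by
  let f : S →* SL(2, F) × SL(2, F) := p.prod q
  have hcomm {x y : S} : Commute (f x) (f y) ↔ Commute (p x) (p y) ∧ Commute (q x) (q y) :=
    Prod.commute_iff
  have habel {x y : S} (hx : Commute (f x) (f z)) (hy : Commute (f y) (f z)) :
      Commute (f x) (f y) :=
    hcomm.2 ⟨commute_of_notMem_center hz (hcomm.1 hx).1 (hcomm.1 hy).1,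
      commute_of_notMem_center (mt (hpq z).2 hz) (hcomm.1 hx).2 (hcomm.1 hy).2⟩
  -- the squares of the elements commuting with `z`; all other elements have square `(-1, -1)`
  obtain ⟨K, hmem⟩ := exists_subgroup_mem_iff_eq_sq f z fun x y => habel
  have hK {x : S} (hpx : p x = -1) (hqx : q x = -1) : x ∈ K := (hmem x).2
    ⟨z, Commute.refl _, Prod.ext (hpx.trans hpz.symm) (hqx.trans hqz.symm)⟩
  refine ⟨K, fun x => ?_, fun x => hK, ?_⟩
  · by_cases hx : Commute (f x) (f z)
    · exact (hmem _).2 ⟨x, hx, map_pow f x 2⟩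
    · have hpx : ¬Commute (p x) (p z) := fun h =>
        hx (hcomm.2 ⟨h, commute_of_commute hpq hpz (hq x) h⟩)
      have hqx : ¬Commute (q x) (q z) := fun h =>
        hx (hcomm.2 ⟨commute_of_commute (fun x => (hpq x).symm) hqz (hp x) h, h⟩)
      refine hK ?_ ?_
      · rw [map_pow, (commute_or_sq_eq_neg_one (hp x)).resolve_left hpx]
      · rw [map_pow, (commute_or_sq_eq_neg_one (hq x)).resolve_left hqx]
  · intro x hpx hqx hx
    obtain ⟨y, -, hy⟩ := (hmem x).1 hx
    have hpy : p y ^ 2 = -1 := (congrArg Prod.fst hy).symm.trans hpx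
    have hqy : q y ^ 2 = 1 := (congrArg Prod.snd hy).symm.trans hqx
    rcases mem_center_iff_eq_one_or_neg_one.1 ((hpq y).2 (mem_center_of_sq_eq_one hqy)) with h | h
    · rw [h, one_pow] at hpy
      exact neg_one_ne_one_of_two_ne_zero hpy.symm
    · rw [h, neg_one_sq] at hpy
      exact neg_one_ne_one_of_two_ne_zero hpy.symm

open scoped commutatorElement in
theorem exists_subgroup_of_isPGroup [Finite S] (hS : IsPGroup 2 S)
    (hpq : ∀ x, p x ∈ Subgroup.center SL(2, F) ↔ q x ∈ Subgroup.center SL(2, F)) :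
    ∃ K : Subgroup S, (∀ x, x ^ 2 ∈ K) ∧ (∀ x, p x = -1 → q x = -1 → x ∈ K) ∧
      ∀ x, p x = -1 → q x = 1 → x ∉ K := by
  by_cases hcenter : ∀ x, p x ∈ Subgroup.center SL(2, F)
  · exact exists_subgroup_of_forall_mem_center hcenter fun x => (hpq x).1 (hcenter x)
  push Not at hcenter
  obtain ⟨x₀, hx₀⟩ := hcenter
  let π := QuotientGroup.mk' (Subgroup.center SL(2, F))
  have hπ {t : SL(2, F)} : π t = 1 ↔ t ∈ Subgroup.center SL(2, F) := QuotientGroup.eq_one_iff t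
  obtain ⟨z, hz, hz2, hcomm⟩ := exists_map_ne_one_of_isPGroup hS (π.comp p) (mt hπ.1 hx₀)
  have hpz2 : p (z ^ 2) ∈ Subgroup.center SL(2, F) := by rwa [← hπ, map_pow, map_pow]
  replace hz : p z ∉ Subgroup.center SL(2, F) := mt hπ.2 hz
  refine exists_subgroup_of_notMem_center hpq hz ?_ ?_ hcomm fun x => ?_
  · exact sq_eq_neg_one_of_sq_mem_center hz (map_pow p z 2 ▸ hpz2)
  · exact sq_eq_neg_one_of_sq_mem_center (mt (hpq z).2 hz) (map_pow q z 2 ▸ (hpq _).1 hpz2)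
  · have hp : (π.comp p) ⁅x, z⁆ = 1 := by
      rw [map_commutatorElement, commutatorElement_eq_one_iff_commute]
      exact hcomm x
    have hq : (π.comp q) ⁅x, z⁆ = 1 := hπ.2 ((hpq _).1 (hπ.1 hp))
    rwa [map_commutatorElement, commutatorElement_eq_one_iff_commute] at hq

end LiftingSubgroups

theorem exists_sign_of_sq_mem {S : Type*} [Group S] [Finite S] {K : Subgroup S}
    (hsq : ∀ x, x ^ 2 ∈ K) {a : S} (ha : a ∉ K) :
    ∃ χ : S →* ℤˣ, χ a ≠ 1 ∧ ∀ x ∈ K, χ x = 1 := by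
  have : K.Normal := by
    refine ⟨fun x hx g => ?_⟩
    have hconj : g * x * g⁻¹ = (g * x) ^ 2 * x⁻¹ * (g ^ 2)⁻¹ := by
      simp only [sq, mul_inv_rev, mul_assoc, mul_inv_cancel_left]
    exact hconj ▸ mul_mem (mul_mem (hsq _) (inv_mem hx)) (inv_mem (hsq g))
  have hsq' (x : S ⧸ K) : x ^ 2 = 1 := by
    obtain ⟨x, rfl⟩ := QuotientGroup.mk_surjective x
    rw [← QuotientGroup.mk_pow, QuotientGroup.eq_one_iff]
    exact hsq x
  have hinv (x : S ⧸ K) : x⁻¹ = x := inv_eq_of_mul_eq_one_right (sq x ▸ hsq' x)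
  let _ : CommGroup (S ⧸ K) :=
    { (inferInstance : Group (S ⧸ K)) with
      mul_comm := fun x y => by rw [← hinv (x * y), mul_inv_rev, hinv, hinv] }
  have : HasEnoughRootsOfUnity ℤ 2 :=
    { prim := ⟨-1, IsPrimitiveRoot.neg_one 0 (by decide)⟩
      cyc := inferInstance }
  have : HasEnoughRootsOfUnity ℤ (Monoid.exponent (S ⧸ K)) :=
    .of_dvd ℤ (Monoid.exponent_dvd_of_forall_pow_eq_one hsq')
  obtain ⟨χ, hχ⟩ := CommGroup.exists_apply_ne_one_of_hasEnoughRootsOfUnity (S ⧸ K) ℤ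
    (a := (a : S ⧸ K)) (by rwa [ne_eq, QuotientGroup.eq_one_iff])
  refine ⟨χ.comp (QuotientGroup.mk' K), hχ, fun x hx => ?_⟩
  rw [MonoidHom.comp_apply, QuotientGroup.mk'_apply, (QuotientGroup.eq_one_iff x).2 hx, map_one]

theorem pow_index_sylow_two_eq_self {S : Type*} [Group S] [Finite S] (P : Sylow 2 S) {x : S}
    (hx : x ^ 2 = 1) : x ^ (P : Subgroup S).index = x := by
  obtain ⟨i, hi⟩ := Nat.not_even_iff_odd.1 fun h => P.not_dvd_index (even_iff_two_dvd.1 h)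
  rw [hi, pow_succ, pow_mul, hx, one_pow, one_mul]

theorem inv_mul_pow_mul_of_mem_center {S : Type*} [Group S] {x : S} (hx : x ∈ Subgroup.center S)
    (k : ℕ) (g : S) : g⁻¹ * x ^ k * g = x ^ k := by
  rw [mul_assoc, ← Subgroup.mem_center_iff.1 (pow_mem hx k) g, inv_mul_cancel_left]

theorem mem_sylow_two_of_mem_center {S : Type*} [Group S] [Finite S] (P : Sylow 2 S) {x : S}
    (hx : x ∈ Subgroup.center S) (hx2 : x ^ 2 = 1) : x ∈ P := by
  have hmem : x ^ (P : Subgroup S).index ∈ P :=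
    MonoidHom.transfer_eq_pow_aux x fun k g _ => inv_mul_pow_mul_of_mem_center hx k g
  rwa [pow_index_sylow_two_eq_self P hx2] at hmem

theorem exists_sign_extension {S : Type*} [Group S] [Finite S] {P : Sylow 2 S} (χ : P →* ℤˣ) :
    ∃ ψ : S →* ℤˣ, ∀ x : P, x.1 ∈ Subgroup.center S → x ^ 2 = 1 → ψ x = χ x := by
  -- the transfer restricts to `x ↦ x ^ [S : P]` on central elements, and the index is odd
  refine ⟨χ.transfer, fun x hx hx2 => ?_⟩
  rw [χ.transfer_eq_pow x.1 fun k g _ => inv_mul_pow_mul_of_mem_center hx k g]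
  exact congrArg χ (Subtype.ext (pow_index_sylow_two_eq_self P (congrArg Subtype.val hx2)))

theorem exists_injective_hom_of_sign {A B : Type*} [Group A] [Group B] {E : Subgroup (A × B)}
    {a : A} {b : B} (ha : (a, 1) ∈ E) (hb : (1, b) ∈ E) (hA : ∀ t, (t, 1) ∈ E → t = 1 ∨ t = a)
    (hB : ∀ s, (1, s) ∈ E → s = 1 ∨ s = b) (hsurj : ∀ t, ∃ s, (t, s) ∈ E) {χ : E →* ℤˣ}
    (hχa : χ ⟨_, ha⟩ ≠ 1) (hχb : χ ⟨_, hb⟩ ≠ 1) :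
    ∃ φ : A →* B, Function.Injective φ ∧ ∀ t, (t, φ t) ∈ E := by
  let graph : Subgroup (A × B) := χ.ker.map E.subtype
  have hgraph {e : A × B} : e ∈ graph ↔ ∃ h : e ∈ E, χ ⟨e, h⟩ = 1 := by
    simp only [graph, Subgroup.mem_map, MonoidHom.mem_ker, Subtype.exists, Subgroup.subtype_apply,
      exists_and_right, exists_eq_right]
  have hfst {s : B} (h : (1, s) ∈ graph) : s = 1 := by
    obtain ⟨hE, hχ⟩ := hgraph.1 h
    refine (hB s hE).resolve_right ?_
    rintro rfl
    exact hχb hχ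
  have hsnd {t : A} (h : (t, 1) ∈ graph) : t = 1 := by
    obtain ⟨hE, hχ⟩ := hgraph.1 h
    refine (hA t hE).resolve_right ?_
    rintro rfl
    exact hχa hχ
  have hbij : Function.Bijective (Prod.fst ∘ graph.subtype) := by
    refine ⟨(injective_iff_map_eq_one ((MonoidHom.fst A B).comp graph.subtype)).2 ?_, fun t => ?_⟩
    · rintro ⟨⟨t, s⟩, h⟩ (rfl : t = 1)
      exact Subtype.ext (Prod.ext rfl (hfst h))
    · obtain ⟨s, hs⟩ := hsurj t
      by_cases hχ : χ ⟨_, hs⟩ = 1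
      · exact ⟨⟨(t, s), hgraph.2 ⟨hs, hχ⟩⟩, rfl⟩
      · have hsb : χ (⟨_, hs⟩ * ⟨_, hb⟩) = 1 := by
          rw [map_mul, Int.units_ne_iff_eq_neg.1 hχ, Int.units_ne_iff_eq_neg.1 hχb]
          rfl
        exact ⟨⟨(t, s) * (1, b), hgraph.2 ⟨mul_mem hs hb, hsb⟩⟩, mul_one t⟩
  obtain ⟨φ, hφ⟩ := Subgroup.exists_eq_graph hbij
  have hmem (t : A) : (t, φ t) ∈ graph := hφ ▸ rfl
  refine ⟨φ, (injective_iff_map_eq_one φ).2 fun t ht => ?_, fun t => (hgraph.1 (hmem t)).1⟩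
  exact hsnd (ht ▸ hmem t)

variable [NeZero (2 : F)] {S : Type*} [Group S] [Finite S]

theorem exists_sign_of_mem_center_iff {p q : S →* SL(2, F)}
    (hinj : Function.Injective (p.prod q))
    (hpq : ∀ x, p x ∈ Subgroup.center SL(2, F) ↔ q x ∈ Subgroup.center SL(2, F)) {a b : S}
    (ha : p.prod q a = (-1, 1)) (hb : p.prod q b = (1, -1)) :
    ∃ χ : S →* ℤˣ, χ a ≠ 1 ∧ χ b ≠ 1 := by
  have hacentral : a ∈ Subgroup.center S := Subgroup.mem_center_iff.2 fun x => hinj <| by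
    rw [map_mul, map_mul, ha]; ext1 <;> simp
  have hbcentral : b ∈ Subgroup.center S := Subgroup.mem_center_iff.2 fun x => hinj <| by
    rw [map_mul, map_mul, hb]; ext1 <;> simp
  have ha2 : a ^ 2 = 1 := hinj (by rw [map_pow, ha, map_one]; ext1 <;> simp)
  have hb2 : b ^ 2 = 1 := hinj (by rw [map_pow, hb, map_one]; ext1 <;> simp)
  obtain ⟨P⟩ : Nonempty (Sylow 2 S) := inferInstance
  obtain ⟨K, hsq, hK, hK'⟩ := exists_subgroup_of_isPGroup P.2
    (p := p.comp (P : Subgroup S).subtype) (q := q.comp (P : Subgroup S).subtype) fun x => hpq x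
  let a' : P := ⟨a, mem_sylow_two_of_mem_center P hacentral ha2⟩
  let b' : P := ⟨b, mem_sylow_two_of_mem_center P hbcentral hb2⟩
  obtain ⟨hpa, hqa⟩ := Prod.ext_iff.1 ha
  obtain ⟨hpb, hqb⟩ := Prod.ext_iff.1 hb
  have hab : a' * b' ∈ K := by
    refine hK _ ?_ ?_
    · rw [map_mul]; exact (congrArg₂ _ hpa hpb).trans (mul_one _)
    · rw [map_mul]; exact (congrArg₂ _ hqa hqb).trans (one_mul _)
  obtain ⟨χ, hχa, hχ⟩ := exists_sign_of_sq_mem hsq (hK' a' hpa hqa)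
  have hχb : χ b' ≠ 1 := fun h => hχa (by rw [← hχ _ hab, map_mul, h, mul_one])
  obtain ⟨ψ, hψ⟩ := exists_sign_extension χ
  refine ⟨ψ, ?_, ?_⟩
  · exact (hψ a' hacentral (Subtype.ext ha2)).trans_ne hχa
  · exact (hψ b' hbcentral (Subtype.ext hb2)).trans_ne hχb

theorem exists_injective_lift {H K : Subgroup SL(2, F)} [Finite H] [Finite K]
    (hH : -1 ∈ H) (hK : -1 ∈ K) {E : Subgroup (H × K)}
    (hE : ∀ t s, (t, s) ∈ E →
      (t.1 ∈ Subgroup.center SL(2, F) ↔ s.1 ∈ Subgroup.center SL(2, F)))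
    (hcenter : ∀ t s, t.1 ∈ Subgroup.center SL(2, F) → s.1 ∈ Subgroup.center SL(2, F) →
      (t, s) ∈ E)
    (hsurj : ∀ t, ∃ s, (t, s) ∈ E) :
    ∃ φ₂ : H →* K, Function.Injective φ₂ ∧ ∀ t, (t, φ₂ t) ∈ E := by
  have hneg : (-1 : SL(2, F)) ∈ Subgroup.center SL(2, F) :=
    mem_center_iff_eq_one_or_neg_one.2 (Or.inr rfl)
  have ha : ((⟨-1, hH⟩, 1) : H × K) ∈ E := hcenter _ _ hneg (one_mem _)
  have hb : ((1, ⟨-1, hK⟩) : H × K) ∈ E := hcenter _ _ (one_mem _) hneg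
  obtain ⟨χ, hχa, hχb⟩ := exists_sign_of_mem_center_iff
    (p := H.subtype.comp ((MonoidHom.fst H K).comp E.subtype))
    (q := K.subtype.comp ((MonoidHom.snd H K).comp E.subtype)) (a := ⟨_, ha⟩) (b := ⟨_, hb⟩)
    (fun e e' h => Subtype.ext (Prod.ext (Subtype.ext (Prod.ext_iff.1 h).1)
      (Subtype.ext (Prod.ext_iff.1 h).2)))
    (fun e => hE _ _ e.2) rfl rfl
  refine exists_injective_hom_of_sign ha hb (fun t ht => ?_) (fun s hs => ?_) hsurj hχa hχb
  · exact (mem_center_iff_eq_one_or_neg_one.1 ((hE t 1 ht).2 (one_mem _))).imp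
      Subtype.ext Subtype.ext
  · exact (mem_center_iff_eq_one_or_neg_one.1 ((hE 1 s hs).1 (one_mem _))).imp
      Subtype.ext Subtype.ext

end Lifting

/-! ### The degenerate locus of `f₁` and the closed orbit -/

section ClosedOrbit

theorem f₁_ne_zero {A : Matrix (Fin 2) (Fin 2) ℂ} (hA : A.det ≠ 0) : f₁ A ≠ 0 := by
  intro h
  have hzero := eq_zero_of_sexticCoord_eq_zero (subst_mem A.adjugate octahedralForm.2) h
  refine octahedralForm_ne_zero (MvPolynomial.funext fun x => ?_)
  have hx := congrArg (eval (A.mulVec x)) hzero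
  rw [eval_subst, Matrix.mulVec_mulVec, Matrix.adjugate_mul, Matrix.smul_mulVec, Matrix.one_mulVec,
    eval_smul_of_isHomogeneous octahedralForm.2, map_zero] at hx
  rw [map_zero]
  exact (mul_eq_zero.1 hx).resolve_left (pow_ne_zero _ hA)

theorem continuous_mk {X : Type*} [TopologicalSpace X] {v : X → Fin 7 → ℂ} (hv : Continuous v)
    (h0 : ∀ x, v x ≠ 0) : Continuous fun x => (Projectivization.mk ℂ (v x) (h0 x) : P6) :=
  (continuous_coinduced_rng (f := fun v : {v : Fin 7 → ℂ // v ≠ 0} =>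
    (Projectivization.mk ℂ v.1 v.2 : P6))).comp (hv.subtype_mk h0)

theorem continuous_sexticCoord_subst (f : V 6) :
    Continuous fun B : Matrix (Fin 2) (Fin 2) ℂ => sexticCoord (subst B f.1) := by
  refine continuous_pi fun i => ?_
  obtain ⟨c, hc⟩ := exists_forall_eq_sum_eval
    (LinearMap.proj i ∘ₗ isLinearMap_sexticCoord.mk' _ ∘ₗ (V 6).subtype)
  have hsum (B : Matrix (Fin 2) (Fin 2) ℂ) : sexticCoord (subst B f.1) i =
      ∑ x ∈ c.support, c x * eval (B.mulVec x) f.1 := by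
    have hB := hc ⟨subst B f.1, subst_mem B f.2⟩
    simp only [Finsupp.sum, eval_subst] at hB
    exact hB
  simp only [hsum]
  exact continuous_finsetSum _ fun x _ => continuous_const.mul
    ((MvPolynomial.continuous_eval f.1).comp (continuous_id.matrix_mulVec continuous_const))

theorem coe_formRep_inv {m : ℕ} (A : SL(2, ℂ)) (p : V m) :
    (formRep m A⁻¹ p).1 = subst A.1 p.1 := by
  conv_rhs => rw [← inv_inv A]
  rfl

theorem mk_sexticCoord_subst_mem_orbit {f : V 6} {B : Matrix (Fin 2) (Fin 2) ℂ} (hB : B.det ≠ 0)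
    (h : sexticCoord (subst B f.1) ≠ 0) : Projectivization.mk ℂ _ h ∈ orbit f := by
  obtain ⟨b, -, B, rfl⟩ := exists_eq_smul_coe hB
  have hsmul : sexticCoord (subst (b • B.1) f.1) = b ^ 6 • sexticCoord (formRep 6 B⁻¹ f).1 := by
    rw [subst_smul f.2, isLinearMap_sexticCoord.map_smul, coe_formRep_inv]
  have h0 : sexticCoord (formRep 6 B⁻¹ f).1 ≠ 0 := fun h0 => h (by rw [hsmul, h0, smul_zero])
  exact ⟨B⁻¹, h0, (Projectivization.mk_eq_mk_iff' ℂ _ _ h h0).2 ⟨b ^ 6, hsmul.symm⟩⟩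

theorem dense_det_ne_zero {ι : Type*} [Fintype ι] [DecidableEq ι] :
    Dense {B : Matrix ι ι ℂ | B.det ≠ 0} := by
  intro B
  have hfin : {ε : ℂ | (ε • (1 : Matrix ι ι ℂ) + B).det = 0}.Finite := by
    refine (Polynomial.finite_setOfPred_isRoot (-B).charpoly_monic.ne_zero).subset fun ε hε => ?_
    rw [Set.mem_ofPred_eq, Polynomial.IsRoot, Matrix.eval_charpoly, sub_neg_eq_add,
      Matrix.scalar_apply, ← Matrix.smul_one_eq_diagonal]
    exact hε
  have hcont : Continuous fun ε : ℂ => ε • (1 : Matrix ι ι ℂ) + B := by fun_prop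
  simpa only [zero_smul, zero_add] using
    map_mem_closure hcont ((hfin.countable.dense_compl ℂ) 0) fun ε hε => hε

theorem mk_sexticCoord_subst_mem_closure_orbit {f : V 6} {B : Matrix (Fin 2) (Fin 2) ℂ}
    (h : sexticCoord (subst B f.1) ≠ 0) :
    Projectivization.mk ℂ (sexticCoord (subst B f.1)) h ∈ closure (orbit f) := by
  let mkSubst (C : {B : Matrix (Fin 2) (Fin 2) ℂ // sexticCoord (subst B f.1) ≠ 0}) : P6 :=
    Projectivization.mk ℂ (sexticCoord (subst C.1 f.1)) C.2
  have hcont : Continuous mkSubst :=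
    continuous_mk ((continuous_sexticCoord_subst f).comp continuous_subtype_val) Subtype.prop
  have hopen : IsOpen {B : Matrix (Fin 2) (Fin 2) ℂ | sexticCoord (subst B f.1) ≠ 0} :=
    isOpen_ne_fun (continuous_sexticCoord_subst f) continuous_const
  have hB : mkSubst ⟨B, h⟩ ∈ closure (orbit f) := by
    have hdense := (dense_det_ne_zero.preimage hopen.isOpenMap_subtype_val) ⟨B, h⟩
    refine map_mem_closure (f := mkSubst) hcont hdense fun C hC => ?_
    exact mk_sexticCoord_subst_mem_orbit hC C.2
  exact hB

theorem exists_eq_vecMulVec_of_det_eq_zero {K : Type*} [Field K] {B : Matrix (Fin 2) (Fin 2) K}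
    (hB : B.det = 0) : ∃ w ℓ : Fin 2 → K, B = Matrix.vecMulVec w ℓ := by
  obtain ⟨v, hv, hBv⟩ := Matrix.exists_mulVec_eq_zero_iff.2 hB
  have hrow (i : Fin 2) : B i 0 * v 0 + B i 1 * v 1 = 0 := by
    simpa [Matrix.mulVec, dotProduct] using congrFun hBv i
  obtain h0 | h1 : v 0 ≠ 0 ∨ v 1 ≠ 0 := by
    simpa [Function.ne_iff, Fin.exists_fin_two] using hv
  · refine ⟨fun i => B i 1 / v 0, ![-v 1, v 0], Matrix.ext fun i => Fin.forall_fin_two.2 ⟨?_, ?_⟩⟩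
    · simpa [Matrix.vecMulVec_apply, field] using by linear_combination hrow i
    · simp [Matrix.vecMulVec_apply, h0]
  · refine ⟨fun i => B i 0 / v 1, ![v 1, -v 0], Matrix.ext fun i => Fin.forall_fin_two.2 ⟨?_, ?_⟩⟩
    · simp [Matrix.vecMulVec_apply, h1]
    · simpa [Matrix.vecMulVec_apply, field] using by linear_combination hrow i

theorem subst_vecMulVec {m : ℕ} {f : MvPolynomial (Fin 2) ℂ} (hf : f ∈ V m) (w ℓ : Fin 2 → ℂ) :
    subst (Matrix.vecMulVec w ℓ) f = C (eval w f) * (∑ j, C (ℓ j) * X j) ^ m :=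
  MvPolynomial.funext fun x => by
    rw [eval_subst, Matrix.vecMulVec_mulVec, op_smul_eq_smul,
      eval_smul_of_isHomogeneous hf, mul_comm, map_mul, eval_C, map_pow, map_sum]
    simp only [dotProduct, map_mul, eval_C, eval_X]

theorem mk_f₁_mem_closedTwoDimOrbit {A : Matrix (Fin 2) (Fin 2) ℂ} (hA : A.det = 0)
    (h : f₁ A ≠ 0) : Projectivization.mk ℂ (f₁ A) h ∈ closedTwoDimOrbit := by
  obtain ⟨w, ℓ, hw⟩ := exists_eq_vecMulVec_of_det_eq_zero (B := A.adjugate) (by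
    rw [Matrix.det_adjugate, hA, Fintype.card_fin, zero_pow (by norm_num)])
  have htangent : eval 1 tangentForm.1 = 1 := by simp [tangentForm]
  have hf₁ : f₁ A = eval w octahedralForm.1 •
      sexticCoord (subst (Matrix.vecMulVec 1 ℓ) tangentForm.1) := by
    rw [f₁, hw, subst_vecMulVec octahedralForm.2, subst_vecMulVec tangentForm.2, htangent, C_1,
      one_mul, ← isLinearMap_sexticCoord.map_smul, smul_eq_C_mul]
  have hne : sexticCoord (subst (Matrix.vecMulVec 1 ℓ) tangentForm.1) ≠ 0 := fun h0 =>
    h (by rw [hf₁, h0, smul_zero])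
  rw [(Projectivization.mk_eq_mk_iff' ℂ _ _ h hne).2 ⟨_, hf₁.symm⟩]
  exact mk_sexticCoord_subst_mem_closure_orbit hne

end ClosedOrbit

/-! ### Equivariance of Galois lifts -/

section Lifts

theorem dense_eval_ne_zero {σ : Type*} {r : MvPolynomial σ ℂ} (hr : r ≠ 0) :
    Dense {x : σ → ℂ | eval x r ≠ 0} := by
  intro x
  obtain ⟨y, hy⟩ : ∃ y, eval y r ≠ 0 := by
    contrapose! hr
    exact MvPolynomial.funext fun y => by rw [hr, map_zero]
  let line (s : ℂ) : σ → ℂ := x + s • (y - x)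
  let q : Polynomial ℂ :=
    aeval (fun i => Polynomial.C (x i) + Polynomial.X * Polynomial.C (y i - x i)) r
  have hq (s : ℂ) : q.eval s = eval (line s) r := by
    have h := comp_aeval_apply (f := fun i =>
      Polynomial.C (x i) + Polynomial.X * Polynomial.C (y i - x i)) (Polynomial.aeval s) r
    rw [Polynomial.coe_aeval_eq_eval] at h
    rw [h, aeval_eq_eval]
    congr 2
    ext i
    simp [line]
  have hq0 : q ≠ 0 := fun h => hy (by simpa [h, line] using (hq 1).symm)
  have hdense : Dense {s : ℂ | q.IsRoot s}ᶜ :=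
    (Polynomial.finite_setOfPred_isRoot hq0).countable.dense_compl ℂ
  have hline : Continuous line := by fun_prop
  simpa [line] using map_mem_closure hline (hdense 0) (t := {x | eval x r ≠ 0})
    fun s hs => by rwa [Set.mem_ofPred_eq, ← hq]

theorem exists_forall_eq_of_forall_exists_eval_eq {σ ι S K : Type*} [Finite S] [Field K]
    [Infinite K] (f g : S → ι → MvPolynomial σ K) {r : MvPolynomial σ K} (hr : r ≠ 0)
    (h : ∀ x, eval x r ≠ 0 → ∃ s, ∀ i, eval x (f s i) = eval x (g s i)) :
    ∃ s, ∀ i, f s i = g s i := by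
  have := Fintype.ofFinite S
  by_contra! hne
  choose i hi using hne
  have hprod : (∏ s, (f s (i s) - g s (i s))) * r ≠ 0 :=
    mul_ne_zero (Finset.prod_ne_zero_iff.2 fun s _ => sub_ne_zero.2 (hi s)) hr
  refine hprod (MvPolynomial.funext fun x => ?_)
  rw [map_mul, map_prod, map_zero]
  by_contra hx
  obtain ⟨s, hs⟩ := h x (right_ne_zero_of_mul hx)
  exact Finset.prod_ne_zero_iff.1 (left_ne_zero_of_mul hx) s (Finset.mem_univ s)
    (by rw [map_sub, hs, sub_self])

theorem continuous_apply_apply_mk {d m : ℕ} {φ : P1 → P1} {F : P1 → P6}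
    (hφ : IsMorphismOfDegree d φ) (hF : IsMorphismOfDegree m F) :
    Continuous fun x : {x : Fin 2 → ℂ // x ≠ 0} => F (φ (Projectivization.mk ℂ x.1 x.2)) := by
  obtain ⟨p, -, hφp⟩ := hφ.exists_isGivenByForms
  obtain ⟨q, -, hFq⟩ := hF.exists_isGivenByForms
  choose hp0 hφp using hφp
  choose hq0 hFq using hFq
  simp only [hφp, hFq]
  refine continuous_mk (continuous_pi fun j => (MvPolynomial.continuous_eval (q j)).comp
    (continuous_pi fun k => (MvPolynomial.continuous_eval (p k)).comp continuous_subtype_val)) _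

theorem forall_mem_of_forall_eval_ne_zero {d m : ℕ} (hd : 0 < d) {φ : P1 → P1} {F : P1 → P6}
    (hφ : IsMorphismOfDegree d φ) (hF : IsMorphismOfDegree m F) {S : Set P6} (hS : IsClosed S)
    {r : MvPolynomial (Fin 2) ℂ} (hr : r ≠ 0)
    (h : ∀ x hx, eval x r ≠ 0 → F (φ (Projectivization.mk ℂ x hx)) ∈ S) (p : P1) : F p ∈ S := by
  obtain ⟨q, rfl⟩ := hφ.surjective hd p
  induction q using Projectivization.ind with
  | h x hx =>
    have hopen : IsOpen {x : Fin 2 → ℂ | x ≠ 0} := isOpen_ne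
    have hdense := (dense_eval_ne_zero hr).preimage hopen.isOpenMap_subtype_val ⟨x, hx⟩
    refine hS.closure_subset (map_mem_closure
      (f := fun y : {y : Fin 2 → ℂ // y ≠ 0} => F (φ (Projectivization.mk ℂ y.1 y.2)))
      (continuous_apply_apply_mk hφ hF) hdense fun y hy => h y.1 y.2 hy)

theorem exists_mul_transpose_eq_smul {A B : Matrix (Fin 2) (Fin 2) ℂ} (hA : A.det ≠ 0)
    (hB : B.det ≠ 0) {k : ℂ} (h : f₁ B = k • f₁ A) :
    ∃ s ∈ binaryOctahedral, ∃ l : ℂ, B * s.1.transpose = l • A := by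
  obtain ⟨s, hs, l, -, rfl⟩ := exists_smul_mul_of_f₁_eq_smul hA hB h
  refine ⟨(s⁻¹).transpose, transpose_mem_binaryOctahedral (inv_mem hs), l, ?_⟩
  rw [Matrix.SpecialLinearGroup.coe_transpose, Matrix.transpose_transpose, Matrix.smul_mul,
    mul_assoc, ← Matrix.SpecialLinearGroup.coe_mul, mul_inv_cancel,
    Matrix.SpecialLinearGroup.coe_one, mul_one]

theorem subst_ne_zero (t : SL(2, ℂ)) {p : MvPolynomial (Fin 2) ℂ} (hp : p ≠ 0) :
    subst t.1 p ≠ 0 := by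
  contrapose! hp
  refine MvPolynomial.funext fun x => ?_
  rw [← mulVec_inv_mulVec t x, ← eval_subst, hp, map_zero, map_zero]

variable {n : ℕ} {φ : P1 → P1} {F : P1 → P6} {g : P1 → P3} {a b c e : V n}

/-- The matrix with rows `(a, b)` and `(c, e)` as a matrix of polynomials; `formMatrix` consists of
its values. -/
noncomputable def polyMatrix (a b c e : V n) : Matrix (Fin 2) (Fin 2) (MvPolynomial (Fin 2) ℂ) :=
  !![a.1, b.1; c.1, e.1]

theorem polyMatrix_mem (i j : Fin 2) : polyMatrix a b c e i j ∈ V n := by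
  fin_cases i <;> fin_cases j <;> simp [polyMatrix]

theorem map_eval_polyMatrix (x : Fin 2 → ℂ) :
    (polyMatrix a b c e).map (eval x) = formMatrix a b c e x :=
  Matrix.ext fun i j => by fin_cases i <;> fin_cases j <;> rfl

theorem eval_det_polyMatrix (x : Fin 2 → ℂ) :
    eval x (polyMatrix a b c e).det = (formMatrix a b c e x).det := by
  rw [RingHom.map_det, RingHom.mapMatrix_apply, map_eval_polyMatrix]

theorem IsGivenBy.isBasePointFree (hg : IsGivenBy g a b c e) :
    IsBasePointFree fun ij : Fin 2 × Fin 2 => polyMatrix a b c e ij.1 ij.2 := by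
  intro y hy
  obtain ⟨h, -⟩ := hg y hy
  contrapose! h
  exact (map_eval_polyMatrix y).symm.trans (Matrix.ext fun i j => h (i, j))

theorem Commutes.apply_mk (hc : Commutes φ g F) (hg : IsGivenBy g a b c e) (x : Fin 2 → ℂ)
    (hx : x ≠ 0) (h : f₁ (formMatrix a b c e x) ≠ 0) :
    F (φ (Projectivization.mk ℂ x hx)) = Projectivization.mk ℂ _ h :=
  let ⟨h₁, h₂⟩ := hg x hx
  hc.2 _ _ h₁ h₂ h

theorem Commutes.exists_f₁_ne_zero (hc : Commutes φ g F) (hg : IsGivenBy g a b c e) :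
    ∃ x, f₁ (formMatrix a b c e x) ≠ 0 := by
  obtain ⟨⟨p, A, hA, hp, hf⟩, -⟩ := hc
  induction p using Projectivization.ind with
  | h x hx =>
    refine ⟨x, fun h => hf ?_⟩
    obtain ⟨hx', hgx⟩ := hg x hx
    obtain ⟨k, rfl⟩ := (Projectivization.mk_eq_mk_iff' ℂ A _ hA hx').1 (hp.symm.trans hgx)
    rw [f₁_smul, h, smul_zero]

theorem det_polyMatrix_ne_zero {d m : ℕ} (hd : 0 < d) (hφ : IsMorphismOfDegree d φ)
    (hF : IsMorphismOfDegree m F) (hF2 : ¬ ∀ p, F p ∈ closedTwoDimOrbit)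
    (hg : IsGivenBy g a b c e) (hc : Commutes φ g F) : (polyMatrix a b c e).det ≠ 0 := by
  intro hdet
  obtain ⟨x₀, hx₀⟩ := hc.exists_f₁_ne_zero hg
  obtain ⟨i, hi⟩ := Function.ne_iff.1 hx₀
  obtain ⟨ψ, -, heval⟩ := exists_eval_eq_f₁_formMatrix a b c e
  have hψ : ψ i ≠ 0 := fun h => hi (by rw [← heval, h, map_zero]; rfl)
  refine hF2 (forall_mem_of_forall_eval_ne_zero hd hφ hF isClosed_closure hψ fun x hx hψx => ?_)
  have hf : f₁ (formMatrix a b c e x) ≠ 0 := fun h => hψx (by rw [heval, h]; rfl)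
  rw [hc.apply_mk hg x hx hf]
  exact mk_f₁_mem_closedTwoDimOrbit (by rw [← eval_det_polyMatrix, hdet, map_zero]) hf

theorem exists_mul_transpose_formMatrix_eq_smul (hg : IsGivenBy g a b c e) (hc : Commutes φ g F)
    {t : SL(2, ℂ)} (ht : t ∈ binaryGroup (deckGroup φ)) {x : Fin 2 → ℂ} (hx : x ≠ 0)
    (hA : (formMatrix a b c e x).det ≠ 0)
    (hB : (formMatrix a b c e ((t⁻¹).1.mulVec x)).det ≠ 0) :
    ∃ s ∈ binaryOctahedral, ∃ l : ℂ,
      formMatrix a b c e ((t⁻¹).1.mulVec x) * s.1.transpose = l • formMatrix a b c e x := by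
  have htx := hc.apply_mk hg _ (mulVec_ne_zero t⁻¹ hx) (f₁_ne_zero hB)
  rw [← moebius_mk t⁻¹ x hx, apply_moebius_of_mem (inv_mem ht),
    hc.apply_mk hg x hx (f₁_ne_zero hA)] at htx
  obtain ⟨k, hk⟩ := (Projectivization.mk_eq_mk_iff' ℂ _ _ _ _).1 htx.symm
  exact exists_mul_transpose_eq_smul hA hB hk.symm

/-- The matrix of forms `x ↦ M (t⁻¹ x) sᵀ`, where `M` is the matrix with rows `(a, b)`, `(c, e)`:
its rows are the images of those of `M` under `t` acting on forms and `s` on `ℂ²`. -/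
noncomputable def transformedMatrix (t s : SL(2, ℂ)) (a b c e : V n) :
    Matrix (Fin 2) (Fin 2) (MvPolynomial (Fin 2) ℂ) :=
  (polyMatrix a b c e).map (subst (t⁻¹).1) * s.1.transpose.map C

theorem transformedMatrix_mem (t s : SL(2, ℂ)) (i j : Fin 2) :
    transformedMatrix t s a b c e i j ∈ V n := by
  refine Submodule.sum_mem (V n) fun k _ => ?_
  rw [mul_comm]
  exact IsHomogeneous.C_mul (subst_mem _ (polyMatrix_mem i k)) _

theorem map_eval_transformedMatrix (t s : SL(2, ℂ)) (x : Fin 2 → ℂ) :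
    (transformedMatrix t s a b c e).map (eval x) =
      formMatrix a b c e ((t⁻¹).1.mulVec x) * s.1.transpose := by
  rw [transformedMatrix, Matrix.map_mul, Matrix.map_map, Matrix.map_map, ← map_eval_polyMatrix]
  congr 1 <;> ext i j <;> simp [eval_subst]

theorem det_transformedMatrix (t s : SL(2, ℂ)) :
    (transformedMatrix t s a b c e).det = subst (t⁻¹).1 (polyMatrix a b c e).det :=
  MvPolynomial.funext fun x => by
    rw [RingHom.map_det, RingHom.mapMatrix_apply, map_eval_transformedMatrix, Matrix.det_mul,
      Matrix.det_transpose, s.2, mul_one, eval_subst, eval_det_polyMatrix]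

theorem exists_transformedMatrix_proportional (hdet : (polyMatrix a b c e).det ≠ 0)
    (hg : IsGivenBy g a b c e) (hc : Commutes φ g F) {t : SL(2, ℂ)}
    (ht : t ∈ binaryGroup (deckGroup φ)) :
    ∃ s ∈ binaryOctahedral, ∀ I J : Fin 2 × Fin 2,
      transformedMatrix t s a b c e I.1 I.2 * polyMatrix a b c e J.1 J.2 =
        transformedMatrix t s a b c e J.1 J.2 * polyMatrix a b c e I.1 I.2 := by
  obtain ⟨s, hs⟩ := exists_forall_eq_of_forall_exists_eval_eq
    (fun (s : binaryOctahedral) (IJ : (Fin 2 × Fin 2) × (Fin 2 × Fin 2)) =>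
      transformedMatrix t s a b c e IJ.1.1 IJ.1.2 * polyMatrix a b c e IJ.2.1 IJ.2.2)
    (fun s IJ => transformedMatrix t s a b c e IJ.2.1 IJ.2.2 * polyMatrix a b c e IJ.1.1 IJ.1.2)
    (mul_ne_zero (mul_ne_zero hdet (subst_ne_zero t⁻¹ hdet)) (X_ne_zero 0)) fun x hx => by
      rw [map_mul, map_mul, eval_subst, eval_det_polyMatrix, eval_det_polyMatrix, eval_X] at hx
      have hx0 : x ≠ 0 := fun h => right_ne_zero_of_mul hx (congrFun h 0)
      obtain ⟨s, hs, l, hl⟩ := exists_mul_transpose_formMatrix_eq_smul hg hc ht hx0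
        (left_ne_zero_of_mul (left_ne_zero_of_mul hx))
        (right_ne_zero_of_mul (left_ne_zero_of_mul hx))
      have heval (I : Fin 2 × Fin 2) : eval x (transformedMatrix t s a b c e I.1 I.2) =
          l * eval x (polyMatrix a b c e I.1 I.2) := by
        rw [← map_eval_transformedMatrix, ← map_eval_polyMatrix] at hl
        exact congrFun₂ hl I.1 I.2
      refine ⟨⟨s, hs⟩, fun IJ => ?_⟩
      simp only [map_mul, heval]
      ring
  exact ⟨s.1, s.2, fun I J => hs (I, J)⟩

theorem exists_equivariant (hdet : (polyMatrix a b c e).det ≠ 0) (hg : IsGivenBy g a b c e)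
    (hc : Commutes φ g F) {t : SL(2, ℂ)} (ht : t ∈ binaryGroup (deckGroup φ)) :
    ∃ s ∈ binaryOctahedral, ∃ k : ℂ, k ≠ 0 ∧ ∀ x,
      formMatrix a b c e ((t⁻¹).1.mulVec x) * s.1.transpose = k • formMatrix a b c e x := by
  obtain ⟨s, hs, hprop⟩ := exists_transformedMatrix_proportional hdet hg hc ht
  obtain ⟨k, hk⟩ := hg.isBasePointFree.exists_eq_C_mul
    (fun I : Fin 2 × Fin 2 => transformedMatrix_mem t s I.1 I.2)
    (fun I => polyMatrix_mem I.1 I.2) hprop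
  have hsmul : transformedMatrix t s a b c e =
      (C k : MvPolynomial (Fin 2) ℂ) • polyMatrix a b c e := Matrix.ext fun i j => hk (i, j)
  refine ⟨s, hs, k, ?_, fun x => ?_⟩
  · rintro rfl
    apply subst_ne_zero t⁻¹ hdet
    rw [← det_transformedMatrix t s, hsmul, map_zero, zero_smul, Matrix.det_zero]
  · rw [← map_eval_transformedMatrix, hsmul, ← map_eval_polyMatrix]
    ext i j
    simp

end Lifts

/-! ### Galois lifts as pairs of eigenvectors -/

section Eigenvectors

theorem isOneDimIrreducible_of_finrank_eq_one {H U : Type*} [Group H] [AddCommGroup U]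
    [Module ℂ U] {ρ : Representation ℂ H U} {S : Subrepresentation ρ}
    (h : Module.finrank ℂ S.toSubmodule = 1) : IsOneDimIrreducible S := by
  have hsimple : IsSimpleOrder (Submodule ℂ S.toSubmodule) :=
    (isSimpleModule_iff_finrank_eq_one.2 h).toIsSimpleOrder
  have hnontriv : Nontrivial (Subrepresentation S.toRepresentation) :=
    ⟨⊥, ⊤, fun h => bot_ne_top (α := Submodule ℂ S.toSubmodule)
      (congrArg Subrepresentation.toSubmodule h)⟩
  exact ⟨h, ⟨fun T => (eq_bot_or_eq_top T.toSubmodule).imp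
    (fun h => Subrepresentation.toSubmodule_injective h)
    (fun h => Subrepresentation.toSubmodule_injective h)⟩⟩

section General

variable {K H U : Type*} [Field K] [Group H] [AddCommGroup U] [Module K U]
  (ρ : Representation K H U)

/-- The line spanned by a common eigenvector `v`, with eigenvalues `χ`, as a subrepresentation. -/
def eigenline (χ : H → K) (v : U) (h : ∀ t, ρ t v = χ t • v) : Subrepresentation ρ where
  toSubmodule := Submodule.span K {v}
  apply_mem_toSubmodule t w hw := by
    obtain ⟨k, rfl⟩ := Submodule.mem_span_singleton.1 hw
    rw [map_smul, h, smul_smul]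
    exact Submodule.smul_mem _ _ (Submodule.mem_span_singleton_self v)

theorem eigenline_toRepresentation_apply {χ : H → K} {v : U} (h : ∀ t, ρ t v = χ t • v) (t : H)
    (x : Submodule.span K {v}) : (eigenline ρ χ v h).toRepresentation t x = χ t • x := by
  obtain ⟨x, hx⟩ := x
  obtain ⟨k, rfl⟩ := Submodule.mem_span_singleton.1 hx
  apply Subtype.ext
  change ρ t (k • v) = χ t • k • v
  rw [map_smul, h, smul_comm]

theorem nonempty_equiv_eigenline {χ : H → K} {v w : U} (hv0 : v ≠ 0) (hw0 : w ≠ 0)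
    (hv : ∀ t, ρ t v = χ t • v) (hw : ∀ t, ρ t w = χ t • w) :
    Nonempty ((eigenline ρ χ v hv).toRepresentation.Equiv
      (eigenline ρ χ w hw).toRepresentation) := by
  let f : Submodule.span K {v} ≃ₗ[K] Submodule.span K {w} :=
    (LinearEquiv.toSpanNonzeroSingleton K U v hv0).symm.trans
      (LinearEquiv.toSpanNonzeroSingleton K U w hw0)
  refine ⟨Representation.Equiv.mk f fun t => LinearMap.ext fun x => ?_⟩
  exact (congrArg f (eigenline_toRepresentation_apply ρ hv t x)).trans
    ((map_smul f _ _).trans (eigenline_toRepresentation_apply ρ hw t (f x)).symm)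

/-- The group elements for which all vectors in `s` are eigenvectors, with a common eigenvalue. -/
def eigenSubgroup (s : Set U) : Subgroup H where
  carrier := {t | ∃ k : K, k ≠ 0 ∧ ∀ v ∈ s, ρ t v = k • v}
  one_mem' := ⟨1, one_ne_zero, by simp⟩
  mul_mem' := by
    rintro t t' ⟨k, hk, h⟩ ⟨k', hk', h'⟩
    refine ⟨k' * k, mul_ne_zero hk' hk, fun v hv => ?_⟩
    rw [map_mul, Module.End.mul_apply, h' v hv, map_smul, h v hv, smul_smul]
  inv_mem' := by
    rintro t ⟨k, hk, h⟩
    refine ⟨k⁻¹, inv_ne_zero hk, fun v hv => ?_⟩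
    rw [eq_inv_smul_iff₀ hk, ← map_smul, ← h v hv, ρ.inv_self_apply]

end General

theorem exists_eigenlines {H U : Type*} [Group H] [AddCommGroup U] [Module ℂ U]
    (ρ : Representation ℂ H U) {v w : U} (hvw : LinearIndependent ℂ ![v, w])
    (h : eigenSubgroup ρ {v, w} = ⊤) :
    ∃ U₁ U₂ : Subrepresentation ρ,
      U₁.toSubmodule = Submodule.span ℂ {v} ∧ U₂.toSubmodule = Submodule.span ℂ {w} ∧
      IsOneDimIrreducible U₁ ∧ IsOneDimIrreducible U₂ ∧
      Nonempty (U₁.toRepresentation.Equiv U₂.toRepresentation) := by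
  choose χ _ heigen using fun t => h.ge (Subgroup.mem_top t)
  have hv t : ρ t v = χ t • v := heigen t v (by simp)
  have hw t : ρ t w = χ t • w := heigen t w (by simp)
  have hv0 : v ≠ 0 := hvw.ne_zero 0
  have hw0 : w ≠ 0 := hvw.ne_zero 1
  exact ⟨eigenline ρ χ v hv, eigenline ρ χ w hw, rfl, rfl,
    isOneDimIrreducible_of_finrank_eq_one (finrank_span_singleton hv0),
    isOneDimIrreducible_of_finrank_eq_one (finrank_span_singleton hw0),
    nonempty_equiv_eigenline ρ hv0 hw0 hv hw⟩

variable {n : ℕ}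

theorem row_inj {p q p' q' : V n} : row p q = row p' q' ↔ p = p' ∧ q = q' := by
  refine ⟨fun h => ?_, fun h => by rw [h.1, h.2]⟩
  have hcoord (i : Fin 2) : TensorProduct.piScalarRight ℂ ℂ (V n) (Fin 2) (row p q) i =
    TensorProduct.piScalarRight ℂ ℂ (V n) (Fin 2) (row p' q') i := by rw [h]
  exact ⟨by simpa [row] using hcoord 0, by simpa [row] using hcoord 1⟩

theorem smul_row (k : ℂ) (p q : V n) : k • row p q = row (k • p) (k • q) := by
  simp only [row, smul_add, TensorProduct.smul_tmul']

theorem row_add (p q p' q' : V n) : row p q + row p' q' = row (p + p') (q + q') := by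
  simp only [row, TensorProduct.add_tmul]
  abel

theorem linearIndependent_rows {a b c e : V n} (hdet : (polyMatrix a b c e).det ≠ 0) :
    LinearIndependent ℂ ![row a b, row c e] := by
  have hzero (α β : ℂ) (h : α • row a b + β • row c e = 0) : α = 0 ∧ β = 0 := by
    have h0 : (0 : V n ⊗[ℂ] (Fin 2 → ℂ)) = row 0 0 := by simp [row]
    rw [smul_row, smul_row, row_add, h0, row_inj, Subtype.ext_iff, Subtype.ext_iff] at h
    have hrows : Matrix.vecMul ![C α, C β] (polyMatrix a b c e) = 0 := by
      ext j : 1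
      fin_cases j
      · simpa [polyMatrix, Matrix.vecMul, smul_eq_C_mul] using h.1
      · simpa [polyMatrix, Matrix.vecMul, smul_eq_C_mul] using h.2
    have hαβ := Matrix.eq_zero_of_vecMul_eq_zero hdet hrows
    exact ⟨by simpa using congrFun hαβ 0, by simpa using congrFun hαβ 1⟩
  have hiff := LinearIndependent.pair_iff (R := ℂ) (x := row a b) (y := row c e)
  exact hiff.2 hzero

/-- The action of `SL₂ × SL₂` on `V n ⊗ ℂ²`; each `tensorRep n φ₂` is its restriction along the
graph of `φ₂`. -/
noncomputable def pairRep (n : ℕ) : Representation ℂ (SL(2, ℂ) × SL(2, ℂ)) (V n ⊗[ℂ] (Fin 2 → ℂ)) :=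
  Representation.tprod ((formRep n).comp (MonoidHom.fst _ _)) (stdRep.comp (MonoidHom.snd _ _))

theorem stdRep_single (s : SL(2, ℂ)) (i : Fin 2) : stdRep s (Pi.single i 1) =
    s.1 0 i • Pi.single 0 1 + s.1 1 i • (Pi.single 1 1 : Fin 2 → ℂ) := by
  ext j
  fin_cases j <;> fin_cases i <;> simp [stdRep]

theorem pairRep_row (t s : SL(2, ℂ)) (p q : V n) : pairRep n (t, s) (row p q) =
    row (s.1 0 0 • formRep n t p + s.1 0 1 • formRep n t q)
      (s.1 1 0 • formRep n t p + s.1 1 1 • formRep n t q) := by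
  have htmul (r : V n) (v : Fin 2 → ℂ) :
    pairRep n (t, s) (r ⊗ₜ v) = formRep n t r ⊗ₜ stdRep s v := rfl
  simp only [row, map_add, htmul, stdRep_single, TensorProduct.tmul_add, TensorProduct.add_tmul,
    TensorProduct.tmul_smul, TensorProduct.smul_tmul']
  abel

theorem eval_formRep (t : SL(2, ℂ)) (p : V n) (x : Fin 2 → ℂ) :
    eval x (formRep n t p).1 = eval ((t⁻¹).1.mulVec x) p.1 := by
  rw [← eval_subst]
  rfl

theorem ext_eval_iff {p q : V n} : p = q ↔ ∀ x, eval x p.1 = eval x q.1 :=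
  ⟨fun h _ => by rw [h], fun h => Subtype.ext (MvPolynomial.funext h)⟩

variable {a b c e : V n} {t s : SL(2, ℂ)}

theorem pairRep_rows_eq_smul_iff {k : ℂ} :
    (pairRep n (t, s) (row a b) = k • row a b ∧ pairRep n (t, s) (row c e) = k • row c e) ↔
      ∀ x, formMatrix a b c e ((t⁻¹).1.mulVec x) * s.1.transpose =
        k • formMatrix a b c e x := by
  simp only [pairRep_row, smul_row, row_inj, ext_eval_iff, ← forall_and]
  refine forall_congr' fun x => ?_
  rw [← Matrix.ext_iff, Fin.forall_fin_two, Fin.forall_fin_two, Fin.forall_fin_two]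
  simp only [formMatrix, Matrix.mul_apply, Fin.sum_univ_two, Matrix.transpose_apply,
    Matrix.smul_apply]
  simp [eval_formRep, smul_eval, mul_comm]

theorem mem_eigenSubgroup_rows : (t, s) ∈ eigenSubgroup (pairRep n) {row a b, row c e} ↔
    ∃ k : ℂ, k ≠ 0 ∧ ∀ x, formMatrix a b c e ((t⁻¹).1.mulVec x) * s.1.transpose =
      k • formMatrix a b c e x :=
  exists_congr fun k => and_congr_right fun _ => by
    simp only [← pairRep_rows_eq_smul_iff, Set.forall_mem_insert, Set.mem_singleton_iff,
      forall_eq]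

theorem exists_ne_zero_coe_eq_smul_one (ht : t ∈ Subgroup.center SL(2, ℂ)) :
    ∃ k : ℂ, k ≠ 0 ∧ t.1 = k • 1 := by
  rcases mem_center_iff_eq_one_or_neg_one.1 ht with rfl | rfl
  · exact ⟨1, one_ne_zero, by simp⟩
  · exact ⟨-1, by simp, by simp⟩

theorem exists_formMatrix_inv_mulVec (a b c e : V n) (ht : t ∈ Subgroup.center SL(2, ℂ)) :
    ∃ k : ℂ, k ≠ 0 ∧ ∀ x,
      formMatrix a b c e ((t⁻¹).1.mulVec x) = k • formMatrix a b c e x := by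
  obtain ⟨k, hk, htk⟩ := exists_ne_zero_coe_eq_smul_one (inv_mem ht)
  refine ⟨k ^ n, pow_ne_zero n hk, fun x => ?_⟩
  rw [htk, Matrix.smul_mulVec, Matrix.one_mulVec, ← map_eval_polyMatrix, ← map_eval_polyMatrix]
  exact Matrix.ext fun i j => eval_smul_of_isHomogeneous (polyMatrix_mem i j) k x

theorem mem_eigenSubgroup_of_mem_center (a b c e : V n) (ht : t ∈ Subgroup.center SL(2, ℂ))
    (hs : s ∈ Subgroup.center SL(2, ℂ)) :
    (t, s) ∈ eigenSubgroup (pairRep n) {row a b, row c e} := by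
  obtain ⟨k, hk, hsk⟩ := exists_ne_zero_coe_eq_smul_one hs
  obtain ⟨l, hl, hform⟩ := exists_formMatrix_inv_mulVec a b c e ht
  refine mem_eigenSubgroup_rows.2 ⟨k * l, mul_ne_zero hk hl, fun x => ?_⟩
  rw [hform, hsk, Matrix.transpose_smul, Matrix.transpose_one, Matrix.mul_smul, mul_one, smul_smul]

theorem mem_center_right_of_mem_eigenSubgroup (hdet : (polyMatrix a b c e).det ≠ 0)
    (hts : (t, s) ∈ eigenSubgroup (pairRep n) {row a b, row c e})
    (ht : t ∈ Subgroup.center SL(2, ℂ)) : s ∈ Subgroup.center SL(2, ℂ) := by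
  obtain ⟨k, -, hk⟩ := mem_eigenSubgroup_rows.1 hts
  obtain ⟨l, hl, hform⟩ := exists_formMatrix_inv_mulVec a b c e ht
  obtain ⟨x, hx⟩ := (dense_eval_ne_zero hdet).nonempty
  have hunit : IsUnit (formMatrix a b c e x) :=
    (Matrix.isUnit_iff_isUnit_det _).2 (isUnit_iff_ne_zero.2 (eval_det_polyMatrix x ▸ hx))
  have hscalar : s.1.transpose = (l⁻¹ * k) • 1 := by
    refine hunit.mul_left_cancel ?_
    rw [Matrix.mul_smul, mul_one, mul_smul, ← hk x, hform, Matrix.smul_mul, inv_smul_smul₀ hl]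
  rw [← Matrix.transpose_inj, Matrix.transpose_transpose, Matrix.transpose_smul,
    Matrix.transpose_one] at hscalar
  exact mem_center_iff_eq_one_or_neg_one.2 (eq_one_or_neg_one_of_coe_eq_smul_one hscalar)

theorem apply_moebius_inv_eq {g : P1 → P3} (hg : IsGivenBy g a b c e)
    (hts : (t, s) ∈ eigenSubgroup (pairRep n) {row a b, row c e})
    (hs : s ∈ Subgroup.center SL(2, ℂ)) (p : P1) : g (moebius t⁻¹ p) = g p := by
  obtain ⟨k, -, hk⟩ := mem_eigenSubgroup_rows.1 hts
  obtain ⟨l, hl, hsl⟩ := exists_ne_zero_coe_eq_smul_one hs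
  induction p using Projectivization.ind with
  | h x hx =>
    obtain ⟨hMx, hgx⟩ := hg x hx
    obtain ⟨hMtx, hgtx⟩ := hg _ (mulVec_ne_zero t⁻¹ hx)
    rw [moebius_mk t⁻¹ x hx, hgx, hgtx, Projectivization.mk_eq_mk_iff']
    refine ⟨l⁻¹ * k, ?_⟩
    rw [mul_smul, ← hk x, hsl, Matrix.transpose_smul, Matrix.transpose_one, Matrix.mul_smul,
      mul_one, inv_smul_smul₀ hl]

theorem mem_center_left_of_mem_eigenSubgroup {φ : P1 → P1} {g : P1 → P3}
    (hg : IsGivenBy g a b c e) (hfaith : ∀ σ ∈ deckGroup φ, (∀ p, g (σ p) = g p) → σ = 1)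
    (ht : t ∈ binaryGroup (deckGroup φ))
    (hts : (t, s) ∈ eigenSubgroup (pairRep n) {row a b, row c e})
    (hs : s ∈ Subgroup.center SL(2, ℂ)) : t ∈ Subgroup.center SL(2, ℂ) := by
  have hone : moebius t⁻¹ = 1 := hfaith _ (inv_mem ht).2 (apply_moebius_inv_eq hg hts hs)
  rw [map_inv, inv_eq_one] at hone
  exact mem_center_iff_eq_one_or_neg_one.2 (eq_one_or_neg_one_of_moebius_eq_one hone)

theorem neg_one_mem_binaryOctahedral : (-1 : SL(2, ℂ)) ∈ binaryOctahedral := by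
  rw [binaryOctahedral_eq_stabilizer]
  refine ⟨1, ?_⟩
  rw [Matrix.SpecialLinearGroup.coe_neg, Matrix.SpecialLinearGroup.coe_one, ← neg_one_smul ℂ,
    subst_smul octahedralForm.2, subst_one, AlgHom.id_apply, Units.val_one]
  norm_num

theorem exists_injective_mem_eigenSubgroup {d m : ℕ} {φ : P1 → P1} (hφ : IsGaloisCovering d φ)
    {F : P1 → P6} {g : P1 → P3} (hF : IsMorphismOfDegree m F)
    (hF2 : ¬ ∀ p, F p ∈ closedTwoDimOrbit) (hg : IsGivenBy g a b c e) (hl : IsGaloisLift φ g F) :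
    ∃ φ₂ : binaryGroup (deckGroup φ) →* binaryOctahedral, Function.Injective φ₂ ∧
      ∀ t, (t.1, (φ₂ t).1) ∈ eigenSubgroup (pairRep n) {row a b, row c e} := by
  obtain ⟨hd, hφm, hcard⟩ := hφ
  obtain ⟨hc, hfaith⟩ := hl
  have hdet := det_polyMatrix_ne_zero hd hφm hF hF2 hg hc
  have hfin : Finite (deckGroup φ) := Nat.finite_of_card_ne_zero (hcard.trans_ne hd.ne')
  have := finite_binaryGroup (deckGroup φ)
  let E : Subgroup (binaryGroup (deckGroup φ) × binaryOctahedral) :=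
    (eigenSubgroup (pairRep n) {row a b, row c e}).comap
      ((binaryGroup (deckGroup φ)).subtype.prodMap binaryOctahedral.subtype)
  refine exists_injective_lift (neg_one_mem_binaryGroup _) neg_one_mem_binaryOctahedral (E := E)
    (fun t s hts => ⟨mem_center_right_of_mem_eigenSubgroup hdet hts,
      mem_center_left_of_mem_eigenSubgroup hg hfaith t.2 hts⟩)
    (fun t s ht hs => mem_eigenSubgroup_of_mem_center a b c e ht hs) fun t => ?_
  obtain ⟨s, hs, hts⟩ := exists_equivariant hdet hg hc t.2
  exact ⟨⟨s, hs⟩, mem_eigenSubgroup_rows.2 hts⟩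

theorem exists_eigenrows_of_isGaloisLift {d m : ℕ} {φ : P1 → P1} (hφ : IsGaloisCovering d φ)
    {F : P1 → P6} {g : P1 → P3} (hF : IsMorphismOfDegree m F)
    (hF2 : ¬ ∀ p, F p ∈ closedTwoDimOrbit) (hg : IsGivenBy g a b c e) (hl : IsGaloisLift φ g F) :
    ∃ φ₂ : binaryGroup (deckGroup φ) →* binaryOctahedral,
      Function.Injective φ₂ ∧
      ∃ U₁ U₂ : Subrepresentation (tensorRep n φ₂),
        U₁.toSubmodule = Submodule.span ℂ {row a b} ∧
        U₂.toSubmodule = Submodule.span ℂ {row c e} ∧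
        IsOneDimIrreducible U₁ ∧ IsOneDimIrreducible U₂ ∧
        Nonempty (U₁.toRepresentation.Equiv U₂.toRepresentation) ∧
        LinearIndependent ℂ ![row a b, row c e] := by
  obtain ⟨φ₂, hinj, hφ₂⟩ := exists_injective_mem_eigenSubgroup hφ hF hF2 hg hl
  have hind := linearIndependent_rows (det_polyMatrix_ne_zero hφ.1 hφ.2.1 hF hF2 hg hl.1)
  have htop : eigenSubgroup (tensorRep n φ₂) {row a b, row c e} = ⊤ :=
    eq_top_iff.2 fun t _ => hφ₂ t
  have hlines := exists_eigenlines (tensorRep n φ₂) (v := row a b) (w := row c e) hind htop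
  obtain ⟨U₁, U₂, h₁, h₂, hirr₁, hirr₂, hequiv⟩ := hlines
  exact ⟨φ₂, hinj, U₁, U₂, h₁, h₂, hirr₁, hirr₂, hequiv, hind⟩

end Eigenvectors

/-! ### Semi-invariant forms -/

section SemiInvariants

theorem eval_mulVec_wedge_mulVec (t : SL(2, ℂ)) (u v : Fin 2 → ℂ) :
    eval (t.1.mulVec u) (wedge (t.1.mulVec v)) = eval u (wedge v) := by
  have hdet := t.2
  rw [Matrix.det_fin_two] at hdet
  simp only [eval_wedge, Matrix.mulVec, dotProduct, Fin.sum_univ_two]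
  linear_combination (v 1 * u 0 - v 0 * u 1) * hdet

theorem exists_free_point {s : Set SL(2, ℂ)} (hs : s.Finite) {Q : MvPolynomial (Fin 2) ℂ}
    (hQ : Q ≠ 0) : ∃ y : Fin 2 → ℂ, y ≠ 0 ∧ eval y Q ≠ 0 ∧
      ∀ t ∈ s, eval (t.1.mulVec y) (wedge y) = 0 → t = 1 ∨ t = -1 := by
  classical
  let w (t : SL(2, ℂ)) : MvPolynomial (Fin 2) ℂ := X 1 * subst t.1 (X 0) - X 0 * subst t.1 (X 1)
  have hw t y : eval y (w t) = eval (t.1.mulVec y) (wedge y) := by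
    simp only [w, map_sub, map_mul, eval_X, eval_subst, eval_wedge]
  let s' := hs.toFinset.filter fun t => ¬ (t = 1 ∨ t = -1)
  have hprod : Q * X 0 * ∏ t ∈ s', w t ≠ 0 := by
    refine mul_ne_zero (mul_ne_zero hQ (X_ne_zero 0)) (Finset.prod_ne_zero_iff.2 fun t ht h => ?_)
    refine (Finset.mem_filter.1 ht).2 (eq_one_or_neg_one_of_forall_eval_wedge_eq_zero fun y => ?_)
    rw [← hw, h, map_zero]
  obtain ⟨y, hy⟩ := (dense_eval_ne_zero hprod).nonempty
  rw [Set.mem_ofPred_eq, map_mul, map_mul, eval_X, map_prod] at hy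
  refine ⟨y, fun h => ?_, left_ne_zero_of_mul (left_ne_zero_of_mul hy), fun t ht h => ?_⟩
  · exact right_ne_zero_of_mul (left_ne_zero_of_mul hy) (congrFun h 0)
  · by_contra hne
    exact Finset.prod_ne_zero_iff.1 (right_ne_zero_of_mul hy) t
      (Finset.mem_filter.2 ⟨hs.mem_toFinset.2 ht, hne⟩) ((hw t y).trans h)

/-- The binary forms of degree `m` on which `H` acts by substitution through the scalars `χ`. -/
noncomputable def semiInvariants {H : Subgroup SL(2, ℂ)} (m : ℕ) (χ : H → ℂ) :
    Submodule ℂ (MvPolynomial (Fin 2) ℂ) :=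
  V m ⊓ ⨅ t : H, LinearMap.eqLocus (subst t.1.1).toLinearMap (χ t • LinearMap.id)

section

variable {H : Subgroup SL(2, ℂ)} {m k : ℕ} {χ ψ : H → ℂ} {P Q : MvPolynomial (Fin 2) ℂ}

theorem mem_semiInvariants :
    P ∈ semiInvariants m χ ↔ P ∈ V m ∧ ∀ t : H, subst t.1.1 P = χ t • P := by
  simp [semiInvariants, Submodule.mem_iInf]

theorem mul_mem_semiInvariants (hP : P ∈ semiInvariants m χ) (hQ : Q ∈ semiInvariants k ψ) :
    P * Q ∈ semiInvariants (m + k) (χ * ψ) := by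
  rw [mem_semiInvariants] at hP hQ ⊢
  exact ⟨IsHomogeneous.mul hP.1 hQ.1, fun t => by
    rw [map_mul, hP.2, hQ.2, smul_mul_smul_comm, Pi.mul_apply]⟩

theorem mem_semiInvariants_of_mul_mem {l : ℕ} (hP : P ∈ semiInvariants m χ) (hP0 : P ≠ 0)
    (hχ : ∀ t, χ t ≠ 0) (hQ : Q ∈ V k) (hPQ : P * Q ∈ semiInvariants l ψ) :
    Q ∈ semiInvariants k (ψ / χ) := by
  refine mem_semiInvariants.2 ⟨hQ, fun t => mul_left_cancel₀ (smul_ne_zero (hχ t) hP0) ?_⟩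
  have h := (mem_semiInvariants.1 hPQ).2 t
  rw [map_mul, (mem_semiInvariants.1 hP).2 t] at h
  rw [h, smul_mul_smul_comm, Pi.div_apply, mul_div_cancel₀ _ (hχ t)]

theorem eval_mulVec_eq_zero (hP : P ∈ semiInvariants m χ) {y : Fin 2 → ℂ} (hy : eval y P = 0)
    (t : H) : eval (t.1.1.mulVec y) P = 0 := by
  rw [← eval_subst, (mem_semiInvariants.1 hP).2, smul_eval, hy, mul_zero]

end

theorem le_of_dvd_of_isHomogeneous {σ R : Type*} [CommRing R] [IsDomain R] {m k : ℕ}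
    {f p : MvPolynomial σ R} (hf : f.IsHomogeneous k) (hp : p.IsHomogeneous m) (hp0 : p ≠ 0)
    (h : f ∣ p) : k ≤ m := by
  obtain ⟨r, rfl⟩ := h
  rw [← hp.totalDegree hp0, ← hf.totalDegree (left_ne_zero_of_mul hp0),
    totalDegree_mul_of_isDomain (left_ne_zero_of_mul hp0) (right_ne_zero_of_mul hp0)]
  exact Nat.le_add_right _ _

variable {d : ℕ} {p : Fin 2 → MvPolynomial (Fin 2) ℂ}

theorem aeval_wedge (p : Fin 2 → MvPolynomial (Fin 2) ℂ) (q : Fin 2 → ℂ) :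
    aeval p (wedge q) = q 1 • p 0 - q 0 • p 1 := by
  simp [wedge, smul_eq_C_mul]

theorem aeval_wedge_mem {S : Submodule ℂ (MvPolynomial (Fin 2) ℂ)} (hp : ∀ i, p i ∈ S)
    (q : Fin 2 → ℂ) : aeval p (wedge q) ∈ S := by
  rw [aeval_wedge]
  exact sub_mem (S.smul_mem _ (hp 0)) (S.smul_mem _ (hp 1))

theorem aeval_wedge_ne_zero (hd : 0 < d) (hp : ∀ i, p i ∈ V d) (hfree : IsBasePointFree p)
    {q : Fin 2 → ℂ} (hq : q ≠ 0) : aeval p (wedge q) ≠ 0 := by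
  intro h
  obtain ⟨i, hi⟩ := Function.ne_iff.1 hq
  obtain ⟨x, hx, hxi⟩ := exists_eval_eq_zero_of_pos hd (hp i)
  obtain ⟨j, hj⟩ := hfree x hx
  rw [aeval_wedge, sub_eq_zero] at h
  have hprop : q i • p j = q j • p i := by
    fin_cases i <;> fin_cases j
    exacts [rfl, h.symm, h, rfl]
  have hij := congrArg (eval x) hprop
  rw [smul_eval, smul_eval, hxi, mul_zero] at hij
  exact mul_ne_zero hi hj hij

variable {φ : P1 → P1}

theorem exists_mem_binaryGroup_moebius_eq {G : Subgroup (Equiv.Perm P1)} (hG : G ≤ SO3) (σ : G) :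
    ∃ t : binaryGroup G, moebius t.1 = σ := by
  obtain ⟨t, ht, htσ⟩ := hG σ.2
  exact ⟨⟨t, ht, show moebius t ∈ G from htσ ▸ σ.2⟩, htσ⟩

section

variable {y : Fin 2 → ℂ}

theorem eval_wedge_ne_zero_of_moebius_ne {G : Subgroup (Equiv.Perm P1)}
    (hfree : ∀ t ∈ binaryGroup G, eval (t.1.mulVec y) (wedge y) = 0 → t = 1 ∨ t = -1)
    {t t' : binaryGroup G} (h : moebius t.1 ≠ moebius t'.1) :
    eval (t.1.1.mulVec y) (wedge (t'.1.1.mulVec y)) ≠ 0 := by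
  intro h0
  rw [← mulVec_inv_mulVec t'.1 (t.1.1.mulVec y), eval_mulVec_wedge_mulVec, Matrix.mulVec_mulVec,
    ← Matrix.SpecialLinearGroup.coe_mul] at h0
  refine h (moebius_eq_moebius_iff.2 ?_)
  refine (hfree _ (t'⁻¹ * t).2 h0).imp (fun h1 => (inv_mul_eq_one.1 h1).symm) fun h1 => ?_
  rw [inv_mul_eq_iff_eq_mul.1 h1, mul_neg_one]

theorem aeval_wedge_dvd_of_forall_eval_mulVec_eq_zero (hφ : IsGaloisCovering d φ)
    (hG : deckGroup φ ≤ SO3) (hp : ∀ i, p i ∈ V d) (hφp : IsGivenByForms φ p) (hy : y ≠ 0)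
    (hfree : ∀ t ∈ binaryGroup (deckGroup φ),
      eval (t.1.mulVec y) (wedge y) = 0 → t = 1 ∨ t = -1)
    {m : ℕ} {P : MvPolynomial (Fin 2) ℂ} (hP : P ∈ V m)
    (hP0 : ∀ t ∈ binaryGroup (deckGroup φ), eval (t.1.mulVec y) P = 0) :
    aeval p (wedge fun i => eval y (p i)) ∣ P := by
  have : Finite (deckGroup φ) := Nat.finite_of_card_ne_zero (hφ.2.2.trans_ne hφ.1.ne')
  have := Fintype.ofFinite (deckGroup φ)
  choose t ht using exists_mem_binaryGroup_moebius_eq hG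
  let z (σ : deckGroup φ) : Fin 2 → ℂ := (t σ).1.1.mulVec y
  have hdvd {k : ℕ} {Q : MvPolynomial (Fin 2) ℂ} (hQ : Q ∈ V k) (hQ0 : ∀ σ, eval (z σ) Q = 0) :
      ∏ σ, wedge (z σ) ∣ Q := by
    refine prod_wedge_dvd _ (fun σ _ => mulVec_ne_zero _ hy) (fun σ _ τ _ hne => ?_) hQ
      fun σ _ => hQ0 σ
    refine eval_wedge_ne_zero_of_moebius_ne hfree ?_
    rwa [ht, ht, Subtype.coe_injective.ne_iff]
  have hdeg : (∏ σ, wedge (z σ)).IsHomogeneous d := by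
    have h := IsHomogeneous.prod Finset.univ _ _ fun σ _ => isHomogeneous_wedge (z σ)
    rwa [Finset.sum_const, Finset.card_univ, ← Nat.card_eq_fintype_card, hφ.2.2, smul_eq_mul,
      mul_one] at h
  have hfibre : ∀ σ, eval (z σ) (aeval p (wedge fun i => eval y (p i))) = 0 := by
    intro σ
    obtain ⟨c, -, hc⟩ := hφp.exists_subst_eq_C_mul hp (t σ).2
    simp only [eval_aeval, eval_wedge, z, ← eval_subst, hc, map_mul, eval_C]
    ring
  obtain ⟨r, hr, hpr⟩ := exists_isHomogeneous_mul_of_dvd hdeg (aeval_wedge_mem hp _)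
    (hdvd (aeval_wedge_mem hp _) hfibre)
  rw [Nat.sub_self] at hr
  obtain ⟨c, rfl⟩ := eq_C_of_isHomogeneous_zero hr
  have hc : c ≠ 0 := by
    rintro rfl
    refine aeval_wedge_ne_zero hφ.1 hp hφp.isBasePointFree (hφp y hy).1 ?_
    rw [hpr, C_0, mul_zero]
  rw [hpr, (hc.isUnit.map C).mul_right_dvd]
  exact hdvd hP fun σ => hP0 _ (t σ).2

end

theorem IsGivenByForms.exists_mem_semiInvariants (hφp : IsGivenByForms φ p) (hp : ∀ i, p i ∈ V d) :
    ∃ κ : binaryGroup (deckGroup φ) → ℂ, (∀ t, κ t ≠ 0) ∧ ∀ i, p i ∈ semiInvariants d κ := by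
  choose κ hκ h using fun t : binaryGroup (deckGroup φ) => hφp.exists_subst_eq_C_mul hp t.2
  exact ⟨κ, hκ, fun i => mem_semiInvariants.2 ⟨hp i, fun t => by rw [h, smul_eq_C_mul]⟩⟩

variable {κ : binaryGroup (deckGroup φ) → ℂ}

theorem exists_eq_smul_add_aeval_wedge_mul (hφ : IsGaloisCovering d φ) (hG : deckGroup φ ≤ SO3)
    (hφp : IsGivenByForms φ p) (hκ : ∀ t, κ t ≠ 0) (hp : ∀ i, p i ∈ semiInvariants d κ) {m : ℕ}
    {χ : binaryGroup (deckGroup φ) → ℂ} {P Q : MvPolynomial (Fin 2) ℂ}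
    (hP : P ∈ semiInvariants m χ) (hQ : Q ∈ semiInvariants m χ) (hQ0 : Q ≠ 0) :
    ∃ (α : ℂ) (q : Fin 2 → ℂ) (R : MvPolynomial (Fin 2) ℂ), (R ≠ 0 → d ≤ m) ∧
      R ∈ semiInvariants (m - d) (χ / κ) ∧ P = α • Q + aeval p (wedge q) * R := by
  have : Finite (deckGroup φ) := Nat.finite_of_card_ne_zero (hφ.2.2.trans_ne hφ.1.ne')
  have := finite_binaryGroup (deckGroup φ)
  obtain ⟨y, hy, hyQ, hfree⟩ := exists_free_point (Set.toFinite (binaryGroup (deckGroup φ))) hQ0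
  have hpV i : p i ∈ V d := (hp i).1
  let α := eval y P / eval y Q
  have hD : P - α • Q ∈ semiInvariants m χ := sub_mem hP (Submodule.smul_mem _ _ hQ)
  have hD0 : eval y (P - α • Q) = 0 := by
    rw [map_sub, smul_eval, div_mul_cancel₀ _ hyQ, sub_self]
  have hW := aeval_wedge_mem hp fun i => eval y (p i)
  have hW0 := aeval_wedge_ne_zero hφ.1 hpV hφp.isBasePointFree (hφp y hy).1
  have hdvd := aeval_wedge_dvd_of_forall_eval_mulVec_eq_zero hφ hG hpV hφp hy hfree hD.1
    fun t ht => eval_mulVec_eq_zero hD hD0 ⟨t, ht⟩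
  obtain ⟨R, hR, hDR⟩ := exists_isHomogeneous_mul_of_dvd hW.1 hD.1 hdvd
  refine ⟨α, _, R, fun hR0 => ?_, mem_semiInvariants_of_mul_mem hW hW0 hκ hR (hDR ▸ hD),
    sub_eq_iff_eq_add'.1 hDR⟩
  exact le_of_dvd_of_isHomogeneous hW.1 hD.1 (hDR ▸ mul_ne_zero hW0 hR0) hdvd

theorem exists_forall_eq_mul_aeval (hφ : IsGaloisCovering d φ) (hG : deckGroup φ ≤ SO3)
    (hφp : IsGivenByForms φ p) (hκ : ∀ t, κ t ≠ 0) (hp : ∀ i, p i ∈ semiInvariants d κ) (m : ℕ)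
    (χ : binaryGroup (deckGroup φ) → ℂ) :
    ∃ (θ : MvPolynomial (Fin 2) ℂ) (k : ℕ),
      ∀ P ∈ semiInvariants m χ, ∃ A ∈ V k, P = θ * aeval p A := by
  induction m using Nat.strong_induction_on generalizing χ with
  | _ m ih =>
    by_cases hr : ∃ r ∈ semiInvariants (m - d) (χ / κ), d ≤ m ∧ r ≠ 0
    · obtain ⟨r, hr, hdm, hr0⟩ := hr
      obtain ⟨θ, k, hθ⟩ := ih (m - d) (Nat.sub_lt (hφ.1.trans_le hdm) hφ.1) (χ / κ)
      obtain ⟨A₀, hA₀, hrA⟩ := hθ r hr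
      obtain ⟨i, hi⟩ := hφp.isBasePointFree.exists_ne_zero
      have hQ : p i * r ∈ semiInvariants m χ := by
        have hχ : κ * (χ / κ) = χ := funext fun t => mul_div_cancel₀ (χ t) (hκ t)
        simpa only [Nat.add_sub_cancel' hdm, hχ] using mul_mem_semiInvariants (hp i) hr
      refine ⟨θ, 1 + k, fun P hP => ?_⟩
      obtain ⟨α, q, R, -, hR, hPR⟩ := exists_eq_smul_add_aeval_wedge_mul hφ hG hφp hκ hp hP hQ
        (mul_ne_zero hi hr0)
      obtain ⟨A, hA, hRA⟩ := hθ R hR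
      refine ⟨α • (X i * A₀) + wedge q * A, add_mem
        (Submodule.smul_mem _ _ (IsHomogeneous.mul (isHomogeneous_X ℂ i) hA₀))
        (IsHomogeneous.mul (isHomogeneous_wedge q) hA), ?_⟩
      rw [hPR, map_add, map_smul, map_mul, map_mul, aeval_X, mul_add, mul_smul_comm,
        mul_left_comm, ← hrA, mul_left_comm, ← hRA]
    by_cases hQ : ∃ Q ∈ semiInvariants m χ, Q ≠ 0
    · obtain ⟨Q, hQ, hQ0⟩ := hQ
      refine ⟨Q, 0, fun P hP => ?_⟩
      obtain ⟨α, q, R, hdm, hR, hPR⟩ := exists_eq_smul_add_aeval_wedge_mul hφ hG hφp hκ hp hP hQ hQ0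
      have hR0 : R = 0 := by
        by_contra h
        exact hr ⟨R, hR, hdm h, h⟩
      refine ⟨C α, isHomogeneous_C _ _, ?_⟩
      rw [hPR, hR0, mul_zero, add_zero, algHom_C, algebraMap_eq, smul_eq_C_mul, mul_comm]
    · push Not at hQ
      exact ⟨0, 0, fun P hP => ⟨0, zero_mem _, by rw [hQ P hP, zero_mul]⟩⟩

end SemiInvariants

/-! ### The curve of a pair of eigenvectors -/

section Descent

theorem exists_forall_mem_isotypic_eq_smul {H U W : Type*} [Group H] [AddCommMonoid U]
    [Module ℂ U] [AddCommGroup W] [Module ℂ W] (ρ : Representation ℂ H U)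
    (σ : Representation ℂ H W) (hW : Module.finrank ℂ W = 1) :
    ∃ χ : H → ℂ, ∀ v ∈ isotypic ρ σ, ∀ t, ρ t v = χ t • v := by
  obtain ⟨w, -, hw⟩ := finrank_eq_one_iff'.1 hW
  choose χ hχ using fun t => hw (σ t w)
  have hσ (t w') : σ t w' = χ t • w' := by
    obtain ⟨k, rfl⟩ := hw w'
    rw [map_smul, ← hχ, smul_comm]
  refine ⟨χ, fun v hv t => ?_⟩
  have hle : isotypic ρ σ ≤ LinearMap.eqLocus (ρ t) (χ t • LinearMap.id) := by
    refine iSup₂_le fun S ⟨f⟩ v hv => ?_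
    have hf : f.toLinearEquiv (S.toRepresentation t ⟨v, hv⟩) = f.toLinearEquiv (χ t • ⟨v, hv⟩) := by
      rw [map_smul, ← hσ]
      exact LinearMap.congr_fun (f.isIntertwining' t) ⟨v, hv⟩
    exact congrArg Subtype.val (f.toLinearEquiv.injective hf)
  exact hle hv

section Curves

variable {k d : ℕ} {F F' : P1 → ℙ ℂ (Fin k → ℂ)} {q : Fin k → MvPolynomial (Fin 2) ℂ}
  {φ : P1 → P1} {p : Fin 2 → MvPolynomial (Fin 2) ℂ}

theorem IsGivenByForms.comp (hF : IsGivenByForms F q) (hφ : IsGivenByForms φ p) :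
    IsGivenByForms (F ∘ φ) fun i => aeval p (q i) := by
  intro x hx
  obtain ⟨h, hφx⟩ := hφ x hx
  simp only [eval_aeval, Function.comp_apply, hφx]
  exact hF _ h

theorem IsGivenByForms.eq_of_forall_eval_ne_zero {q' : Fin k → MvPolynomial (Fin 2) ℂ}
    (hF : IsGivenByForms F q) (hF' : IsGivenByForms F' q') {r : MvPolynomial (Fin 2) ℂ}
    (hr : r ≠ 0) (h : ∀ x hx, eval x r ≠ 0 →
      F (Projectivization.mk ℂ x hx) = F' (Projectivization.mk ℂ x hx)) : F = F' := by
  have hprop i j : q i * q' j = q j * q' i := by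
    refine mul_left_cancel₀ (mul_ne_zero hr (X_ne_zero 0)) (MvPolynomial.funext fun x => ?_)
    simp only [map_mul, eval_X]
    rcases eq_or_ne x 0 with rfl | hx
    · simp
    rcases eq_or_ne (eval x r) 0 with hr0 | hr0
    · simp [hr0]
    have hFx := h x hx hr0
    rw [(hF x hx).2, (hF' x hx).2, mk_eq_mk_iff_mul_eq] at hFx
    rw [hFx i j]
  funext P
  induction P using Projectivization.ind with
  | h x hx =>
    rw [(hF x hx).2, (hF' x hx).2, mk_eq_mk_iff_mul_eq]
    intro i j
    rw [← map_mul, hprop, map_mul]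

theorem IsBasePointFree.exists_isCurve {m : ℕ} (hq : ∀ i, q i ∈ V m) (hfree : IsBasePointFree q) :
    ∃ F : P1 → ℙ ℂ (Fin k → ℂ), IsCurve F ∧ IsGivenByForms F q := by
  have h0 (x : Fin 2 → ℂ) (hx : x ≠ 0) : (fun i => eval x (q i)) ≠ 0 :=
    Function.ne_iff.2 (hfree x hx)
  obtain ⟨F, hF, hFq⟩ := exists_isMorphismOfDegree _
    (exists_form_of_dual (Pi.basisFun ℂ (Fin k)) hq fun _ _ => rfl) h0
  exact ⟨F, ⟨m, hF⟩, fun x hx => ⟨h0 x hx, hFq x hx⟩⟩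

theorem exists_isCurve_forall_apply_eq_mk (hφ : IsGaloisCovering d φ) (hG : deckGroup φ ≤ SO3)
    {m : ℕ} {χ : binaryGroup (deckGroup φ) → ℂ} {ψ : Fin k → MvPolynomial (Fin 2) ℂ}
    (hψ0 : ∃ i, ψ i ≠ 0) {γ : MvPolynomial (Fin 2) ℂ} (hγ : γ ≠ 0)
    (hψ : ∀ i, γ * ψ i ∈ semiInvariants m χ) :
    ∃ F : P1 → ℙ ℂ (Fin k → ℂ), IsCurve F ∧
      ∀ (x : Fin 2 → ℂ) (hx : x ≠ 0) (h : (fun i => eval x (ψ i)) ≠ 0),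
        F (φ (Projectivization.mk ℂ x hx)) = Projectivization.mk ℂ _ h := by
  obtain ⟨p, hp, hφp⟩ := hφ.2.1.exists_isGivenByForms
  obtain ⟨κ, hκ, hpκ⟩ := hφp.exists_mem_semiInvariants hp
  obtain ⟨θ, r, hθ⟩ := exists_forall_eq_mul_aeval hφ hG hφp hκ hpκ m χ
  choose A hA hψA using fun i => hθ _ (hψ i)
  obtain ⟨l, hl⟩ := hψ0
  have hAl : A l ≠ 0 := by
    intro h
    apply mul_ne_zero hγ hl
    rw [hψA, h, map_zero, mul_zero]
  obtain ⟨r', δ, B, -, hB, hAB, hfree⟩ := exists_mul_isBasePointFree hA ⟨l, hAl⟩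
  obtain ⟨F, hF, hFB⟩ := hfree.exists_isCurve hB
  have hψB i : γ * ψ i = θ * aeval p δ * aeval p (B i) := by
    rw [hψA, hAB, map_mul, mul_assoc]
  have hprop i j : aeval p (B i) * ψ j = aeval p (B j) * ψ i := by
    have hθδ : θ * aeval p δ ≠ 0 := left_ne_zero_of_mul (hψB l ▸ mul_ne_zero hγ hl)
    refine mul_left_cancel₀ (mul_ne_zero hθδ hγ) ?_
    linear_combination γ * ψ i * hψB j - γ * ψ j * hψB i
  refine ⟨F, hF, fun x hx h => ?_⟩
  obtain ⟨h', hFφ⟩ := hFB.comp hφp x hx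
  refine hFφ.trans ((mk_eq_mk_iff_mul_eq h' h).2 fun i j => ?_)
  rw [← map_mul, hprop, map_mul]

end Curves

variable {n : ℕ} {a b c e : V n} {g : P1 → P3} {φ : P1 → P1} {F F' : P1 → P6}

theorem exists_formMatrix_eq_smul (h : ∃ x, formMatrix a b c e x ≠ 0) :
    ∃ (k : ℕ) (a' b' c' e' : V k) (γ : MvPolynomial (Fin 2) ℂ), γ ≠ 0 ∧
      (∀ x, formMatrix a b c e x = eval x γ • formMatrix a' b' c' e' x) ∧
      ∀ x ≠ 0, formMatrix a' b' c' e' x ≠ 0 := by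
  obtain ⟨x₀, hx₀⟩ := h
  have h0 : ∃ I : Fin 2 × Fin 2, polyMatrix a b c e I.1 I.2 ≠ 0 := by
    contrapose! hx₀
    ext i j
    rw [← map_eval_polyMatrix, Matrix.map_apply, hx₀ (i, j), map_zero, Matrix.zero_apply]
  obtain ⟨k, γ, q, hγ, hq, hpq, hfree⟩ := exists_mul_isBasePointFree
    (fun I : Fin 2 × Fin 2 => polyMatrix_mem I.1 I.2) h0
  have hval (x i j) : formMatrix (⟨q (0, 0), hq _⟩ : V k) ⟨q (0, 1), hq _⟩ ⟨q (1, 0), hq _⟩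
      ⟨q (1, 1), hq _⟩ x i j = eval x (q (i, j)) := by
    fin_cases i <;> fin_cases j <;> rfl
  refine ⟨k, ⟨q (0, 0), hq _⟩, ⟨q (0, 1), hq _⟩, ⟨q (1, 0), hq _⟩, ⟨q (1, 1), hq _⟩, γ, hγ,
    fun x => ?_, fun x hx hzero => ?_⟩
  · ext i j
    rw [Matrix.smul_apply, hval, ← map_eval_polyMatrix, Matrix.map_apply, hpq (i, j), map_mul,
      smul_eq_mul]
  · obtain ⟨I, hI⟩ := hfree x hx
    rw [← hval, hzero] at hI
    exact hI rfl

theorem exists_isCurve_isGivenBy (h : ∀ x ≠ 0, formMatrix a b c e x ≠ 0) :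
    ∃ g : P1 → P3, IsCurve g ∧ IsGivenBy g a b c e := by
  have heval (x) (I : Fin 2 × Fin 2) :
      (Matrix.stdBasis ℂ (Fin 2) (Fin 2)).repr (formMatrix a b c e x) I =
        eval x (polyMatrix a b c e I.1 I.2) := by
    rw [← map_eval_polyMatrix]
    rfl
  obtain ⟨g, hg, hg'⟩ := exists_isMorphismOfDegree _
    (exists_form_of_dual (Matrix.stdBasis ℂ _ _) (fun I => polyMatrix_mem I.1 I.2) heval) h
  exact ⟨g, ⟨n, hg⟩, fun x hx => ⟨h x hx, hg' x hx⟩⟩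

theorem IsGivenBy.commutes (hg : IsGivenBy g a b c e) (h0 : ∃ x, f₁ (formMatrix a b c e x) ≠ 0)
    (h : ∀ x hx (hf : f₁ (formMatrix a b c e x) ≠ 0),
      F (φ (Projectivization.mk ℂ x hx)) = Projectivization.mk ℂ _ hf) : Commutes φ g F := by
  constructor
  · obtain ⟨x₀, hx₀⟩ := h0
    obtain ⟨l, hl⟩ := Function.ne_iff.1 hx₀
    obtain ⟨ψ, -, heval⟩ := exists_eval_eq_f₁_formMatrix a b c e
    have hψ : ψ l ≠ 0 := fun h => hl (by rw [← heval, h, map_zero, Pi.zero_apply])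
    obtain ⟨x, hx⟩ := (dense_eval_ne_zero (mul_ne_zero hψ (X_ne_zero 0))).nonempty
    rw [Set.mem_ofPred_eq, map_mul, eval_X, heval] at hx
    have hx0 : x ≠ 0 := fun h => right_ne_zero_of_mul hx (congrFun h 0)
    obtain ⟨hM, hgx⟩ := hg x hx0
    exact ⟨_, _, hM, hgx, fun hf => left_ne_zero_of_mul hx (congrFun hf l)⟩
  · intro P M hM hP hf
    induction P using Projectivization.ind with
    | h x hx =>
      rw [(hg x hx).2, eq_comm, Projectivization.mk_eq_mk_iff'] at hP
      obtain ⟨s, rfl⟩ := hP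
      have hfx : f₁ (formMatrix a b c e x) ≠ 0 := by
        rw [f₁_smul] at hf
        exact right_ne_zero_of_smul hf
      rw [h x hx hfx, eq_comm, Projectivization.mk_eq_mk_iff']
      exact ⟨s ^ 6, (f₁_smul _ _).symm⟩

theorem Commutes.eq {d : ℕ} (hd : 0 < d) (hφ : IsMorphismOfDegree d φ)
    (hg : IsGivenBy g a b c e) (hF : IsCurve F) (hF' : IsCurve F') (hc : Commutes φ g F)
    (hc' : Commutes φ g F') : F = F' := by
  obtain ⟨_, hF⟩ := hF
  obtain ⟨_, hF'⟩ := hF'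
  obtain ⟨q, -, hFq⟩ := hF.exists_isGivenByForms
  obtain ⟨q', -, hFq'⟩ := hF'.exists_isGivenByForms
  obtain ⟨p, -, hφp⟩ := hφ.exists_isGivenByForms
  obtain ⟨x₀, hx₀⟩ := hc.exists_f₁_ne_zero hg
  obtain ⟨l, hl⟩ := Function.ne_iff.1 hx₀
  obtain ⟨ψ, -, heval⟩ := exists_eval_eq_f₁_formMatrix a b c e
  have hψ : ψ l ≠ 0 := fun h => hl (by rw [← heval, h, map_zero, Pi.zero_apply])
  refine (hφ.surjective hd).injective_comp_right
    ((hFq.comp hφp).eq_of_forall_eval_ne_zero (hFq'.comp hφp) hψ fun x hx hψx => ?_)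
  have hf : f₁ (formMatrix a b c e x) ≠ 0 := fun h => hψx (by rw [heval, h, Pi.zero_apply])
  exact (hc.apply_mk hg x hx hf).trans (hc'.apply_mk hg x hx hf).symm

theorem exists_forall_mem_semiInvariants {H : Subgroup SL(2, ℂ)} {φ₂ : H →* binaryOctahedral}
    {χ : H → ℂ} (hab : ∀ t, tensorRep n φ₂ t (row a b) = χ t • row a b)
    (hce : ∀ t, tensorRep n φ₂ t (row c e) = χ t • row c e) {m : ℕ}
    {ψ : Fin 7 → MvPolynomial (Fin 2) ℂ} (hψ : ∀ i, ψ i ∈ V m)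
    (heval : ∀ x i, eval x (ψ i) = f₁ (formMatrix a b c e x) i) :
    ∃ κ : H → ℂ, ∀ i, ψ i ∈ semiInvariants m κ := by
  have hf (t : H) : ∃ k : ℂ, ∀ x,
      f₁ (formMatrix a b c e (t.1.1.mulVec x)) = k • f₁ (formMatrix a b c e x) := by
    obtain ⟨ε, hε⟩ := exists_f₁_mul_eq_smul (inv_mem (transpose_mem_binaryOctahedral (φ₂ t⁻¹).2))
    refine ⟨ε * χ t⁻¹ ^ 6, fun x => ?_⟩
    have hM := (pairRep_rows_eq_smul_iff (t := (t⁻¹).1) (s := (φ₂ t⁻¹).1)).1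
      ⟨hab t⁻¹, hce t⁻¹⟩ x
    rw [← InvMemClass.coe_inv, inv_inv, ← Matrix.SpecialLinearGroup.coe_transpose] at hM
    rw [mul_smul, ← f₁_smul, ← hM, ← hε, mul_assoc, ← Matrix.SpecialLinearGroup.coe_mul,
      mul_inv_cancel, Matrix.SpecialLinearGroup.coe_one, mul_one]
  choose κ hκ using hf
  refine ⟨κ, fun i => mem_semiInvariants.2 ⟨hψ i, fun t => MvPolynomial.funext fun x => ?_⟩⟩
  rw [eval_subst, heval, hκ, smul_eval, heval, Pi.smul_apply, smul_eq_mul]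

theorem exists_isInducedBy_existsUnique {d : ℕ} (hφ : IsGaloisCovering d φ)
    (hG : deckGroup φ ≤ SO3) {φ₂ : binaryGroup (deckGroup φ) →* binaryOctahedral}
    {χ : binaryGroup (deckGroup φ) → ℂ} (hab : ∀ t, tensorRep n φ₂ t (row a b) = χ t • row a b)
    (hce : ∀ t, tensorRep n φ₂ t (row c e) = χ t • row c e)
    (hf : ∃ x, f₁ (formMatrix a b c e x) ≠ 0) :
    ∃ g : P1 → P3, IsInducedBy g a b c e ∧ ∃! F : P1 → P6, IsCurve F ∧ Commutes φ g F := by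
  obtain ⟨x₀, hx₀⟩ := hf
  have hM₀ : formMatrix a b c e x₀ ≠ 0 := by
    intro h
    rw [h, ← zero_smul ℂ 0, f₁_smul] at hx₀
    simp at hx₀
  obtain ⟨k, a', b', c', e', γ, hγ, hγM, hM⟩ := exists_formMatrix_eq_smul ⟨x₀, hM₀⟩
  obtain ⟨g, hgc, hg⟩ := exists_isCurve_isGivenBy hM
  obtain ⟨ψ, hψ, heval⟩ := exists_eval_eq_f₁_formMatrix a b c e
  obtain ⟨ψ', -, heval'⟩ := exists_eval_eq_f₁_formMatrix a' b' c' e'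
  obtain ⟨κ, hκ⟩ := exists_forall_mem_semiInvariants hab hce hψ heval
  have hψγ i : ψ i = γ ^ 6 * ψ' i := MvPolynomial.funext fun x => by
    rw [heval, hγM, f₁_smul, Pi.smul_apply, smul_eq_mul, map_mul, map_pow, heval']
  rw [hγM, f₁_smul] at hx₀
  have hx₀' := right_ne_zero_of_smul hx₀
  obtain ⟨l, hl⟩ := Function.ne_iff.1 hx₀'
  have hψ' : ψ' l ≠ 0 := fun h => hl (by rw [← heval', h, map_zero, Pi.zero_apply])
  obtain ⟨F, hF, hFφ⟩ := exists_isCurve_forall_apply_eq_mk hφ hG ⟨l, hψ'⟩ (pow_ne_zero 6 hγ)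
    fun i => hψγ i ▸ hκ i
  have hc : Commutes φ g F := hg.commutes ⟨x₀, hx₀'⟩ fun x hx h => by
    have := funext (heval' x)
    simp only [← this] at h ⊢
    exact hFφ x hx h
  refine ⟨g, ⟨hgc, fun x hx h => ?_⟩, F, ⟨hF, hc⟩, fun F' hF' =>
    hF'.2.eq hφ.1 hφ.2.1 hg hF'.1 hF hc⟩
  rw [(hg x hx).2, eq_comm, Projectivization.mk_eq_mk_iff']
  exact ⟨_, (hγM x).symm⟩

end Descent

end GaloisLift

theorem theorem3p1_general (d : ℕ) (φ : P1 → P1)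
    (hφ : IsGaloisCovering d φ)
    (hG : deckGroup φ ≤ SO3) (n : ℕ) :
    (∀ (F : P1 → P6) (g : P1 → P3)
        (a b c e : V n),
        IsCurve F →
        (¬ ∀ p, F p ∈ closedTwoDimOrbit) →
        IsGivenBy g a b c e →
        IsGaloisLift φ g F →
        ∃ φ₂ : binaryGroup (deckGroup φ) →* binaryOctahedral,
          Function.Injective φ₂ ∧
          ∃ U₁ U₂ : Subrepresentation (tensorRep n φ₂),
            U₁.toSubmodule = Submodule.span ℂ {row a b} ∧
            U₂.toSubmodule = Submodule.span ℂ {row c e} ∧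
            IsOneDimIrreducible U₁ ∧
            IsOneDimIrreducible U₂ ∧
            Nonempty (U₁.toRepresentation.Equiv U₂.toRepresentation) ∧
            LinearIndependent ℂ ![row a b, row c e]) ∧
    (∀ (φ₂ : binaryGroup (deckGroup φ) →* binaryOctahedral)
        (W : Type*) [AddCommGroup W] [Module ℂ W]
        (σ : Representation ℂ (binaryGroup (deckGroup φ)) W)
        (a b c e : V n),
        Module.finrank ℂ W = 1 →
        row a b ∈ isotypic (tensorRep n φ₂) σ →
        row c e ∈ isotypic (tensorRep n φ₂) σ →
        (∃ x, f₁ (formMatrix a b c e x) ≠ 0) →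
        ∃ g : P1 → P3, IsInducedBy g a b c e ∧
          ∃! F : P1 → P6,
            IsCurve F ∧ Commutes φ g F) := by
  refine ⟨fun F g a b c e ⟨_, hF⟩ hF2 hg hl => exists_eigenrows_of_isGaloisLift hφ hF hF2 hg hl, ?_⟩
  intro φ₂ W _ _ σ a b c e hW hab hce hf
  obtain ⟨χ, hχ⟩ := exists_forall_mem_isotypic_eq_smul (tensorRep n φ₂) σ hW
  exact exists_isInducedBy_existsUnique hφ hG (hχ _ hab) (hχ _ hce) hf

theorem theorem3p1 (d : ℕ) (φ : P1 → P1)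
    (hφ : IsGaloisCovering d φ)
    (hG : deckGroup φ ≤ SO3) (n : ℕ) :
    (∀ (F : P1 → P6) (g : P1 → P3)
        (a b c e : V n),
        IsSexticCurve F →
        (¬ ∀ p, F p ∈ closedTwoDimOrbit) →
        IsGivenBy g a b c e →
        IsGaloisLift φ g F →
        ∃ φ₂ : binaryGroup (deckGroup φ) →* binaryOctahedral,
          Function.Injective φ₂ ∧
          ∃ U₁ U₂ : Subrepresentation (tensorRep n φ₂),
            U₁.toSubmodule = Submodule.span ℂ {row a b} ∧
            U₂.toSubmodule = Submodule.span ℂ {row c e} ∧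
            IsOneDimIrreducible U₁ ∧
            IsOneDimIrreducible U₂ ∧
            Nonempty (U₁.toRepresentation.Equiv U₂.toRepresentation) ∧
            LinearIndependent ℂ ![row a b, row c e]) ∧
    (∀ (φ₂ : binaryGroup (deckGroup φ) →* binaryOctahedral)
        (W : Type*) [AddCommGroup W] [Module ℂ W]
        (σ : Representation ℂ (binaryGroup (deckGroup φ)) W)
        (a b c e : V n),
        Module.finrank ℂ W = 1 →
        row a b ∈ isotypic (tensorRep n φ₂) σ →
        row c e ∈ isotypic (tensorRep n φ₂) σ →
        LinearIndependent ℂ ![row a b, row c e] →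
        (∃ x, f₁ (formMatrix a b c e x) ≠ 0) →
        ∃ g : P1 → P3, IsInducedBy g a b c e ∧
          ∃! F : P1 → P6,
            IsCurve F ∧ Commutes φ g F) := by
  obtain ⟨hlift, hdescent⟩ := theorem3p1_general d φ hφ hG n
  exact ⟨fun F g a b c e hF => hlift F g a b c e ⟨6, hF.1⟩,
    fun φ₂ W _ _ σ a b c e hW hab hce _ => hdescent φ₂ W σ a b c e hW hab hce⟩
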